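/- For $s\in\mathbb C$ and a positive integer $m$ let $\eta_s(m)=\sum_{ab=m,\ a,b\ge 1}(a/b)^s$. Let $n\ge 1$ be an integer. Then there is a constant $N_0=N_0(n)$, depending only on $n$, such that for all real numbers $N$ and $t$ with $N\ge t^2\ge 1$ and $N\ge N_0$, at least $$\Big(1-\frac1{20n^2}\Big)\frac{N}{\log N}$$ primes $p$ in the interval $[N,2N]$ satisfy $$|\eta_{nit}(p)|=|p^{2nit}+1|\ \ge\ \frac1{2000^2\,n^4}.$$ -/

import Mathlib

/-- The twisted divisor function `η_s(m) = ∑_{ab = m, a, b ≥ 1} (a / b) ^ s`, for `s : ℂ` and a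
positive integer `m`. The bases `a / b` are positive reals, so the complex power is the usual one. -/
noncomputable def divisorEta (s : ℂ) (m : ℕ) : ℂ :=
  ∑ ab ∈ m.divisorsAntidiagonal, ((ab.1 : ℂ) / (ab.2 : ℂ)) ^ s

/-!
For a prime `p`, `‖η_{nit}(p)‖ = ‖p ^ (2nit) + 1‖ = 2 |cos (n t log p)|`. Hence the primes to be
discarded are those for which `T log p`, with `T = n |t|`, is within a small distance of a zero of
the cosine. In `[N, 2N]` such primes lie in at most `3 T` intervals of length `h = 16 N δ / T`,
where `δ` is half the threshold. As `T ≤ n √N`, the length `h` exceeds `N ^ (1 / 4)` for large `N`,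
so a Brun-Titchmarsh bound `O (h / log h)` for each interval shows that at most
`O (δ N / log N)` primes are discarded. The constant is small enough for this to be at most
`N / (40 n² log N)`, and the prime number theorem provides `(1 - 1 / (40 n²)) N / log N` primes in
`(N, 2N]`.

The two inputs from prime number theory are proved here.

* The prime number theorem, `tendsto_psi_div_atTop`, by the Wiener-Ikehara method. The function
  `g x = ψ (exp x) exp (-x)` is bounded (Chebyshev), and the Laplace transform of `g - 1` extends
  continuously to the closed right half-plane because `ζ` has no zeros on the line `re s = 1`
  (`psi_laplace_transform`). Smoothing by a Fejér kernel and the Riemann-Lebesgue lemma show that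
  all smoothed averages of `g` tend to `1` (`tendsto_integral_mul_fejerKernel`), and the
  monotonicity of `ψ` removes the smoothing (`tendsto_one_of_tendsto_convolution`).
* The Brun-Titchmarsh bound, `eventually_card_primes_le`, by Selberg's sieve. Mathlib diagonalises
  the quadratic form of the `Λ²` sieve; evaluating it at Selberg's weights gives the main term
  `m / S` (`mainSum_selbergWeight`) with `log R ≤ 2 S` (`log_le_two_mul_selbergSum`).
-/

/-! ### The Fejér kernel and the boundary behaviour of a Laplace transform -/

section

open MeasureTheory Filter Set Topology

/-- The Fejér kernel `2 (1 - cos x) / x ^ 2`, the Fourier transform of the triangle function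
`1 - |v|` on `[-1, 1]`. (Its value at `0` is the junk value `0` instead of `1`; it is only ever
integrated.) -/
noncomputable def fejerKernel (x : ℝ) : ℝ := 2 * (1 - Real.cos x) / x ^ 2

lemma fejerKernel_nonneg (x : ℝ) : 0 ≤ fejerKernel x := by
  have := Real.cos_le_one x
  unfold fejerKernel
  exact div_nonneg (by linarith) (sq_nonneg x)

lemma fejerKernel_le (x : ℝ) : fejerKernel x ≤ 5 * (1 + x ^ 2)⁻¹ := by
  unfold fejerKernel
  rcases eq_or_ne x 0 with rfl | hx
  · norm_num
  have hx2 : 0 < x ^ 2 := by positivity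
  have h1 := Real.one_sub_sq_div_two_le_cos (x := x)
  have h2 := Real.neg_one_le_cos x
  rw [← div_eq_mul_inv, div_le_div_iff₀ hx2 (by positivity)]
  nlinarith

lemma measurable_fejerKernel : Measurable fejerKernel := by
  unfold fejerKernel
  fun_prop

lemma integrable_fejerKernel : Integrable fejerKernel := by
  refine (integrable_inv_one_add_sq.const_mul 5).mono' measurable_fejerKernel.aestronglyMeasurable
    (ae_of_all _ fun x ↦ ?_)
  rw [Real.norm_of_nonneg (fejerKernel_nonneg x)]
  exact fejerKernel_le x

lemma integral_fejerKernel_pos : 0 < ∫ x, fejerKernel x := by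
  rw [integral_pos_iff_support_of_nonneg fejerKernel_nonneg integrable_fejerKernel]
  have hsub : Ioo (0 : ℝ) 1 ⊆ Function.support fejerKernel := by
    intro x hx
    have hcos : Real.cos x < 1 := by
      have := Real.cos_lt_cos_of_nonneg_of_le_pi (x := 0) (y := x) le_rfl
        (by linarith [hx.2, Real.pi_gt_three]) hx.1
      simpa using this
    have : 0 < x ^ 2 := by have := hx.1; positivity
    rw [Function.mem_support]
    unfold fejerKernel
    exact (div_pos (by linarith) this).ne'
  refine lt_of_lt_of_le ?_ (measure_mono hsub)
  simp

lemma integral_triangle_mul_exp {x : ℝ} (hx : x ≠ 0) :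
    ∫ v in (-1 : ℝ)..1, ((1 - |v| : ℝ) : ℂ) * Complex.exp (Complex.I * (x * v : ℝ)) =
      (fejerKernel x : ℂ) := by
  set w : ℂ := Complex.I * x with hw
  have hw0 : w ≠ 0 := by simp [hw, hx]
  have hcont : Continuous fun v : ℝ ↦
      ((1 - |v| : ℝ) : ℂ) * Complex.exp (Complex.I * (x * v : ℝ)) := by fun_prop
  rw [← intervalIntegral.integral_add_adjacent_intervals (b := 0)
    (hcont.intervalIntegrable _ _) (hcont.intervalIntegrable _ _)]
  have hE (v : ℝ) : HasDerivAt (fun v : ℝ ↦ Complex.exp (w * v)) (Complex.exp (w * v) * w) v := by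
    have := ((hasDerivAt_id (v : ℂ)).const_mul w).cexp.comp_ofReal
    simpa using this
  have hid (v : ℝ) : HasDerivAt (fun v : ℝ ↦ (v : ℂ)) 1 v := (hasDerivAt_id (v : ℂ)).comp_ofReal
  have h1 : ∫ v in (-1 : ℝ)..0, ((1 - |v| : ℝ) : ℂ) * Complex.exp (Complex.I * (x * v : ℝ)) =
      1 / w - 1 / w ^ 2 + Complex.exp (-w) / w ^ 2 := by
    rw [intervalIntegral.integral_eq_sub_of_hasDerivAt
      (f := fun v : ℝ ↦ (1 + (v : ℂ)) * Complex.exp (w * v) / w - Complex.exp (w * v) / w ^ 2) ?_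
      (hcont.intervalIntegrable _ _)]
    · simp
    · intro v hv
      have hv0 : v ≤ 0 := by
        rw [uIcc_of_le (by norm_num)] at hv; exact hv.2
      have := ((((hid v).const_add 1).mul (hE v)).div_const w).sub ((hE v).div_const (w ^ 2))
      refine this.congr_deriv ?_
      rw [abs_of_nonpos hv0]
      have : Complex.I * ((x * v : ℝ) : ℂ) = w * v := by rw [hw]; push_cast; ring
      rw [this]
      push_cast
      field_simp
      ring
  have h2 : ∫ v in (0 : ℝ)..1, ((1 - |v| : ℝ) : ℂ) * Complex.exp (Complex.I * (x * v : ℝ)) =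
      Complex.exp w / w ^ 2 - 1 / w - 1 / w ^ 2 := by
    rw [intervalIntegral.integral_eq_sub_of_hasDerivAt
      (f := fun v : ℝ ↦ (1 - (v : ℂ)) * Complex.exp (w * v) / w + Complex.exp (w * v) / w ^ 2) ?_
      (hcont.intervalIntegrable _ _)]
    · simp
      ring
    · intro v hv
      have hv0 : 0 ≤ v := by
        rw [uIcc_of_le (by norm_num)] at hv; exact hv.1
      have := ((((hid v).const_sub 1).mul (hE v)).div_const w).add ((hE v).div_const (w ^ 2))
      refine this.congr_deriv ?_
      rw [abs_of_nonneg hv0]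
      have : Complex.I * ((x * v : ℝ) : ℂ) = w * v := by rw [hw]; push_cast; ring
      rw [this]
      push_cast
      field_simp
      ring
  rw [h1, h2]
  have hcos : Complex.exp w + Complex.exp (-w) = 2 * Complex.cos x := by
    rw [Complex.two_cos, hw]; congr 2 <;> ring
  have hx' : (x : ℂ) ≠ 0 := by exact_mod_cast hx
  have hw2 : w ^ 2 = -(x : ℂ) ^ 2 := by rw [hw, mul_pow, Complex.I_sq]; ring
  have : Complex.exp w = 2 * Complex.cos x - Complex.exp (-w) := by rw [← hcos]; ring
  rw [hw2, this]
  unfold fejerKernel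
  push_cast
  field_simp
  ring

lemma integrable_fejerKernel_comp {l : ℝ} (hl : 0 < l) (u : ℝ) :
    Integrable fun x ↦ fejerKernel (l * (u - x)) := by
  have := (integrable_fejerKernel.comp_mul_left' hl.ne').comp_sub_left u
  simpa using this

/-- If the Laplace transform `F` of a bounded function `f` on `(0, ∞)` extends continuously to the
closed half-plane `0 ≤ re s`, then the convolution of `f` with any rescaled Fejér kernel tends to
`0`. On the line `re s = σ` the convolution (damped by `exp (-σ x)`) is the Fourier integral of
`F` against the compactly supported triangle function; the limit `σ → 0` can be taken on both
sides, and the Riemann-Lebesgue lemma applies on the line `re s = 0`. -/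
lemma tendsto_integral_mul_fejerKernel {f : ℝ → ℝ} (hf : Measurable f) {M : ℝ}
    (hM : ∀ x, |f x| ≤ M) {F : ℂ → ℂ} (hF : ContinuousOn F {s | 0 ≤ s.re})
    (hFf : ∀ s : ℂ, 0 < s.re → F s = ∫ x in Ioi (0 : ℝ), (f x : ℂ) * Complex.exp (-s * x))
    {l : ℝ} (hl : 0 < l) :
    Tendsto (fun u ↦ ∫ x in Ioi (0 : ℝ), f x * fejerKernel (l * (u - x))) atTop (𝓝 0) := by
  have hM0 : 0 ≤ M := (abs_nonneg _).trans (hM 0)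
  -- the identity obtained from Fubini's theorem to the right of the boundary line
  have hσ (u σ : ℝ) (hσ0 : 0 < σ) :
      ∫ v in (-1 : ℝ)..1, ((1 - |v| : ℝ) : ℂ) * Complex.exp (Complex.I * (l * u * v : ℝ)) *
          F (σ + Complex.I * (l * v : ℝ)) =
        ∫ x in Ioi (0 : ℝ),
          ((f x * Real.exp (-(σ * x)) * fejerKernel (l * (u - x)) : ℝ) : ℂ) := by
    have e1 : ∀ v : ℝ, ((1 - |v| : ℝ) : ℂ) * Complex.exp (Complex.I * (l * u * v : ℝ)) *
          F (σ + Complex.I * (l * v : ℝ)) = ∫ x in Ioi (0 : ℝ),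
          ((f x * Real.exp (-(σ * x)) : ℝ) : ℂ) *
          (((1 - |v| : ℝ) : ℂ) * Complex.exp (Complex.I * ((l * (u - x)) * v : ℝ))) := by
      intro v
      rw [hFf _ (by simpa using hσ0), ← integral_const_mul]
      congr 1 with x
      push_cast
      have : Complex.exp (-(σ + Complex.I * (l * v)) * x) * Complex.exp (Complex.I * (l * u * v)) =
          Complex.exp (-(σ * x)) * Complex.exp (Complex.I * (l * (u - x) * v)) := by
        rw [← Complex.exp_add, ← Complex.exp_add]; congr 1; ring
      linear_combination ((1 - ((|v| : ℝ) : ℂ)) * f x) * this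
    simp_rw [e1]
    rw [intervalIntegral.integral_of_le (by norm_num), integral_integral_swap]
    · refine integral_congr_ae ?_
      -- the kernel has a junk value at `x = u`
      have hne : ∀ᵐ x ∂(volume.restrict (Ioi (0 : ℝ))), x ≠ u :=
        ae_restrict_of_ae (by simp [ae_iff])
      filter_upwards [hne] with x hx
      rw [integral_const_mul, ← intervalIntegral.integral_of_le (by norm_num),
        integral_triangle_mul_exp (mul_ne_zero hl.ne' (sub_ne_zero.mpr hx.symm))]
      push_cast; ring
    · have hexp : IntegrableOn (fun x : ℝ ↦ M * Real.exp (-(σ * x))) (Ioi 0) := by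
        refine Integrable.const_mul ?_ M
        simpa [IntegrableOn] using integrableOn_exp_mul_Ioi (a := -σ) (by linarith) 0
      have hv : Integrable (fun _ : ℝ ↦ (1 : ℝ)) (volume.restrict (Ioc (-1 : ℝ) 1)) := by
        simp
      refine (hv.mul_prod hexp).mono' ?_ ?_
      · refine Measurable.aestronglyMeasurable ?_
        simp only [Function.uncurry_def]
        fun_prop
      · rw [Measure.prod_restrict]
        filter_upwards [ae_restrict_mem (measurableSet_Ioc.prod measurableSet_Ioi)] with p hp
        have h1 : abs (1 - |p.1|) ≤ 1 := by
          have := abs_le.mpr ⟨hp.1.1.le, hp.1.2⟩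
          rw [abs_le]; constructor <;> linarith [abs_nonneg p.1]
        simp only [Function.uncurry_def, norm_mul, Complex.norm_real, mul_comm Complex.I,
          Complex.norm_exp_ofReal_mul_I, Real.norm_eq_abs, Real.abs_exp, mul_one, one_mul]
        have := mul_le_mul (mul_le_mul_of_nonneg_right (hM p.2) (Real.exp_pos (-(σ * p.2))).le)
          h1 (abs_nonneg _) (by positivity)
        simpa using this
  -- passing to the boundary line
  have hlim (u : ℝ) :
      ∫ v in (-1 : ℝ)..1, ((1 - |v| : ℝ) : ℂ) * Complex.exp (Complex.I * (l * u * v : ℝ)) *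
          F (Complex.I * (l * v : ℝ)) =
        ((∫ x in Ioi (0 : ℝ), f x * fejerKernel (l * (u - x)) : ℝ) : ℂ) := by
    have hF2 : ContinuousOn (fun p : ℝ × ℝ ↦ F (p.1 + Complex.I * (l * p.2 : ℝ)))
        (Icc 0 1 ×ˢ Icc (-1) 1) := by
      refine hF.comp (by fun_prop) fun p hp ↦ ?_
      simpa using hp.1.1
    obtain ⟨B, hB⟩ := (isCompact_Icc.prod isCompact_Icc).exists_bound_of_continuousOn hF2
    have hnhds : ∀ᶠ σ : ℝ in 𝓝[>] 0, σ ∈ Ioc (0 : ℝ) 1 := Ioc_mem_nhdsGT (by norm_num)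
    have t1 : Tendsto (fun σ : ℝ ↦ ∫ v in (-1 : ℝ)..1, ((1 - |v| : ℝ) : ℂ) *
        Complex.exp (Complex.I * (l * u * v : ℝ)) * F (σ + Complex.I * (l * v : ℝ))) (𝓝[>] 0)
        (𝓝 (∫ v in (-1 : ℝ)..1, ((1 - |v| : ℝ) : ℂ) *
        Complex.exp (Complex.I * (l * u * v : ℝ)) * F (Complex.I * (l * v : ℝ)))) := by
      refine intervalIntegral.tendsto_integral_filter_of_dominated_convergence (fun _ ↦ B) ?_ ?_
        (by simp) ?_
      · filter_upwards [hnhds] with σ hσm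
        refine ContinuousOn.aestronglyMeasurable ?_ measurableSet_uIoc
        refine ContinuousOn.mul (by fun_prop) (hF.comp (by fun_prop) fun v _ ↦ ?_)
        simpa using hσm.1.le
      · filter_upwards [hnhds] with σ hσm
        refine ae_of_all _ fun v hv ↦ ?_
        rw [uIoc_of_le (by norm_num)] at hv
        have h1 : abs (1 - |v|) ≤ 1 := by
          have := abs_le.mpr ⟨hv.1.le, hv.2⟩
          rw [abs_le]; constructor <;> linarith [abs_nonneg v]
        simp only [norm_mul, Complex.norm_real, mul_comm Complex.I (((l * u * v : ℝ)) : ℂ),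
          Complex.norm_exp_ofReal_mul_I, Real.norm_eq_abs, mul_one]
        have h2 := hB (σ, v) ⟨⟨hσm.1.le, hσm.2⟩, ⟨hv.1.le, hv.2⟩⟩
        calc _ ≤ 1 * B := mul_le_mul h1 h2 (norm_nonneg _) zero_le_one
          _ = B := one_mul B
      · refine ae_of_all _ fun v hv ↦ ?_
        refine Tendsto.const_mul _ ?_
        have hc : ContinuousWithinAt F {s | 0 ≤ s.re} (Complex.I * (l * v : ℝ)) :=
          hF _ (by simp)
        refine hc.tendsto.comp (tendsto_nhdsWithin_iff.mpr ⟨?_, ?_⟩)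
        · have : Continuous fun σ : ℝ ↦ (σ : ℂ) + Complex.I * (l * v : ℝ) := by fun_prop
          have := (this.tendsto 0).mono_left (nhdsWithin_le_nhds (s := Ioi 0))
          simpa using this
        · filter_upwards [hnhds] with σ hσm
          simpa using hσm.1.le
    have t2 : Tendsto (fun σ : ℝ ↦ ∫ x in Ioi (0 : ℝ),
        ((f x * Real.exp (-(σ * x)) * fejerKernel (l * (u - x)) : ℝ) : ℂ)) (𝓝[>] 0)
        (𝓝 (∫ x in Ioi (0 : ℝ), ((f x * fejerKernel (l * (u - x)) : ℝ) : ℂ))) := by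
      refine tendsto_integral_filter_of_dominated_convergence
        (fun x ↦ M * fejerKernel (l * (u - x))) ?_ ?_
        ((integrable_fejerKernel_comp hl u).const_mul M).integrableOn ?_
      · refine Eventually.of_forall fun σ ↦ Measurable.aestronglyMeasurable ?_
        have := measurable_fejerKernel
        fun_prop
      · filter_upwards [hnhds] with σ hσm
        filter_upwards [ae_restrict_mem measurableSet_Ioi] with x hx
        rw [Complex.norm_real, Real.norm_eq_abs, abs_mul, abs_mul, Real.abs_exp,
          abs_of_nonneg (fejerKernel_nonneg _)]
        refine mul_le_mul_of_nonneg_right ?_ (fejerKernel_nonneg _)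
        have : Real.exp (-(σ * x)) ≤ 1 := by
          rw [Real.exp_le_one_iff]
          have := mul_pos hσm.1 (show 0 < x from hx)
          linarith
        calc _ ≤ M * 1 := mul_le_mul (hM x) this (Real.exp_pos _).le hM0
          _ = M := mul_one M
      · refine ae_of_all _ fun x ↦ ?_
        have : Continuous fun σ : ℝ ↦
            ((f x * Real.exp (-(σ * x)) * fejerKernel (l * (u - x)) : ℝ) : ℂ) := by fun_prop
        have := (this.tendsto 0).mono_left (nhdsWithin_le_nhds (s := Ioi 0))
        simpa using this
    rw [← integral_complex_ofReal]
    refine tendsto_nhds_unique t1 (t2.congr' ?_)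
    filter_upwards [hnhds] with σ hσm
    exact (hσ u σ hσm.1).symm
  -- the Riemann-Lebesgue lemma
  have hRL := Real.tendsto_integral_exp_smul_cocompact
    ((Ioc (-1 : ℝ) 1).indicator fun v ↦ ((1 - |v| : ℝ) : ℂ) * F (Complex.I * (l * v : ℝ)))
  have hw : Tendsto (fun u : ℝ ↦ -(l / (2 * Real.pi)) * u) atTop (cocompact ℝ) := by
    have : -(l / (2 * Real.pi)) < 0 := by
      have := Real.pi_pos
      exact neg_lt_zero.mpr (by positivity)
    exact (tendsto_id.const_mul_atTop_of_neg this).mono_right atBot_le_cocompact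
  have hT := hRL.comp hw
  rw [← tendsto_ofReal_iff]
  refine Tendsto.congr (fun u ↦ ?_) hT
  rw [← hlim u, intervalIntegral.integral_of_le (by norm_num), ← integral_indicator measurableSet_Ioc]
  simp only [Function.comp_apply]
  congr 1 with v
  by_cases hv : v ∈ Ioc (-1 : ℝ) 1
  · rw [indicator_of_mem hv, indicator_of_mem hv, Circle.smul_def, Real.fourierChar_apply, smul_eq_mul]
    have : (2 * Real.pi * -(v * (-(l / (2 * Real.pi)) * u)) : ℝ) = l * u * v := by
      field_simp
    rw [this, mul_comm (((l * u * v : ℝ)) : ℂ) Complex.I]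
    ring
  · simp [indicator_of_notMem hv]

end

/-! ### A Tauberian theorem -/

section

open MeasureTheory Filter Set Topology

lemma exists_fejerKernel_tail_lt {δ η : ℝ} (hδ : 0 < δ) (hη : 0 < η) :
    ∃ l : ℝ, 0 < l ∧
      ∫ y : ℝ in (Icc (-δ) δ)ᶜ, l / (∫ x, fejerKernel x) * fejerKernel (l * y) < η := by
  set c := ∫ x, fejerKernel x with hc
  have hc0 : 0 < c := integral_fejerKernel_pos
  have key : Tendsto (fun l : ℝ ↦ ∫ y : ℝ in (Icc (-(l * δ)) (l * δ))ᶜ, fejerKernel y) atTop (𝓝 0) := by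
    have h0 : ∫ _ : ℝ, (0 : ℝ) = 0 := by simp
    simp_rw [← integral_indicator (measurableSet_Icc.compl)]
    rw [← h0]
    refine tendsto_integral_filter_of_dominated_convergence fejerKernel
      (Eventually.of_forall fun l ↦
        (measurable_fejerKernel.indicator measurableSet_Icc.compl).aestronglyMeasurable)
      (Eventually.of_forall fun l ↦ ae_of_all _ fun y ↦ ?_) integrable_fejerKernel
      (ae_of_all _ fun y ↦ ?_)
    · rw [← Real.norm_of_nonneg (fejerKernel_nonneg y)]
      exact (norm_indicator_le_norm_self _ _).trans (by simp)
    · refine tendsto_const_nhds.congr' ?_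
      filter_upwards [eventually_ge_atTop (|y| / δ)] with l hl
      rw [indicator_of_notMem]
      have : |y| ≤ l * δ := (div_le_iff₀ hδ).mp hl
      simpa [abs_le] using this
  obtain ⟨l, hl, hl0⟩ := ((key.eventually (gt_mem_nhds (show 0 < η * c by positivity))).and
    (eventually_gt_atTop 0)).exists
  refine ⟨l, hl0, ?_⟩
  have e : ∫ y : ℝ in (Icc (-δ) δ)ᶜ, fejerKernel (l * y) =
      l⁻¹ * ∫ y : ℝ in (Icc (-(l * δ)) (l * δ))ᶜ, fejerKernel y := by
    rw [← integral_indicator measurableSet_Icc.compl, ← integral_indicator measurableSet_Icc.compl,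
      ← abs_of_pos (inv_pos.mpr hl0), ← smul_eq_mul, ← Measure.integral_comp_mul_left]
    congr 1 with y
    have : l * y ∈ (Icc (-(l * δ)) (l * δ))ᶜ ↔ y ∈ (Icc (-δ) δ)ᶜ := by
      simp only [mem_compl_iff, mem_Icc, not_iff_not]
      rw [← mul_neg, mul_le_mul_iff_right₀ hl0, mul_le_mul_iff_right₀ hl0]
    by_cases hy : y ∈ (Icc (-δ) δ)ᶜ
    · rw [indicator_of_mem hy, indicator_of_mem (this.mpr hy)]
    · rw [indicator_of_notMem hy, indicator_of_notMem (fun h ↦ hy (this.mp h))]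
  rw [integral_const_mul, e]
  have : l / c * (l⁻¹ * ∫ y : ℝ in (Icc (-(l * δ)) (l * δ))ᶜ, fejerKernel y) =
      (∫ y : ℝ in (Icc (-(l * δ)) (l * δ))ᶜ, fejerKernel y) / c := by field_simp
  rwa [this, div_lt_iff₀ hc0]

/-- Passage from the one-sided convolution of `g - 1` to the normalised convolution of `g`; the
condition `g x = 0` for `x ≤ 0` lets the latter run over the whole line. -/
lemma tendsto_convolution_fejerKernel {g : ℝ → ℝ} (hg : Measurable g) {M : ℝ}
    (hg0 : ∀ x, 0 ≤ g x) (hgM : ∀ x, g x ≤ M) (hneg : ∀ x ≤ 0, g x = 0) {l : ℝ} (hl : 0 < l)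
    (h : Tendsto (fun u ↦ ∫ x in Ioi (0 : ℝ), (g x - 1) * fejerKernel (l * (u - x))) atTop (𝓝 0)) :
    Tendsto (fun u ↦ ∫ y, g (u - y) * (l / (∫ x, fejerKernel x) * fejerKernel (l * y)))
      atTop (𝓝 1) := by
  set c := ∫ x, fejerKernel x with hc
  have hc0 : 0 < c := integral_fejerKernel_pos
  have hk : Integrable fun y ↦ fejerKernel (l * y) := integrable_fejerKernel.comp_mul_left' hl.ne'
  have hint : ∫ y, fejerKernel (l * y) = l⁻¹ * c := by
    rw [Measure.integral_comp_mul_left, abs_of_pos (inv_pos.mpr hl), smul_eq_mul]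
  have h1 : Tendsto (fun u : ℝ ↦ ∫ x in Ioi (0 : ℝ), fejerKernel (l * (u - x))) atTop
      (𝓝 (l⁻¹ * c)) := by
    rw [← hint]
    have e (u : ℝ) : ∫ x in Ioi (0 : ℝ), fejerKernel (l * (u - x)) =
        ∫ y, (Iio u).indicator (fun y ↦ fejerKernel (l * y)) y := by
      rw [← integral_indicator measurableSet_Ioi, ← integral_sub_left_eq_self _ volume u]
      congr 1 with x
      simp [indicator]
    simp_rw [e]
    refine tendsto_integral_filter_of_dominated_convergence (fun y ↦ fejerKernel (l * y))
      (Eventually.of_forall fun u ↦ hk.aestronglyMeasurable.indicator measurableSet_Iio)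
      (Eventually.of_forall fun u ↦ ae_of_all _ fun y ↦ ?_) hk (ae_of_all _ fun y ↦ ?_)
    · rw [← Real.norm_of_nonneg (fejerKernel_nonneg (l * y))]
      exact (norm_indicator_le_norm_self _ _).trans (by simp)
    · refine tendsto_const_nhds.congr' ?_
      filter_upwards [eventually_gt_atTop y] with u hu
      rw [indicator_of_mem (show y ∈ Iio u from hu)]
  have h2 := (h.add h1).const_mul (l / c)
  have : l / c * (0 + l⁻¹ * c) = 1 := by field_simp; ring
  rw [this] at h2
  refine h2.congr fun u ↦ ?_
  have hku := integrable_fejerKernel_comp hl u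
  have hgi : Integrable fun x ↦ g x * fejerKernel (l * (u - x)) := by
    refine hku.bdd_mul hg.aestronglyMeasurable (c := M) (ae_of_all _ fun x ↦ ?_)
    rw [Real.norm_of_nonneg (hg0 x)]; exact hgM x
  rw [← integral_add _ hku.integrableOn]
  · rw [← integral_sub_left_eq_self _ volume u, ← integral_const_mul]
    rw [setIntegral_eq_integral_of_forall_compl_eq_zero]
    · congr 1 with x
      simp only [sub_sub_cancel]
      ring
    · intro x hx
      rw [hneg x (not_lt.mp hx)]
      ring
  · have := (hgi.sub hku).integrableOn (s := Ioi 0)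
    refine this.congr (ae_of_all _ fun x ↦ ?_)
    simp [sub_mul]

/-- The Tauberian step: a bounded nonnegative function `g` with `g x * exp x` monotone whose
averages against all rescaled Fejér kernels tend to `1` tends to `1` itself. Monotonicity makes
`g` change by a factor at most `exp (2 η)` on a window of half-width `η`, and the kernel can be
rescaled to have almost all its mass in that window. -/
lemma tendsto_one_of_tendsto_convolution {g : ℝ → ℝ} (hg : Measurable g) {M : ℝ}
    (hg0 : ∀ x, 0 ≤ g x) (hgM : ∀ x, g x ≤ M) (hmono : Monotone fun x ↦ g x * Real.exp x)
    (h : ∀ l : ℝ, 0 < l → Tendsto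
      (fun u ↦ ∫ y, g (u - y) * (l / (∫ x, fejerKernel x) * fejerKernel (l * y))) atTop (𝓝 1)) :
    Tendsto g atTop (𝓝 1) := by
  set c := ∫ x, fejerKernel x with hc
  have hc0 : 0 < c := integral_fejerKernel_pos
  have hM0 : 0 ≤ M := (hg0 0).trans (hgM 0)
  have hgle {x y : ℝ} (hxy : x ≤ y) : g x ≤ g y * Real.exp (y - x) := by
    have := hmono hxy
    simp only at this
    rw [Real.exp_sub, ← mul_div_assoc, le_div_iff₀ (Real.exp_pos x)]
    exact this
  -- two-sided bounds for a window of half-width `η` and a kernel with mass at most `η` outside it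
  have main (η : ℝ) (hη : 0 < η) (hη1 : η < 1) : ∀ᶠ u in atTop,
      g (u - η) * Real.exp (-(2 * η)) * (1 - η) ≤ 1 + η ∧
      1 - η ≤ g (u + η) * Real.exp (2 * η) + M * η := by
    obtain ⟨l, hl, htail⟩ := exists_fejerKernel_tail_lt hη hη
    rw [← hc] at htail
    set k : ℝ → ℝ := fun y ↦ l / c * fejerKernel (l * y) with hkdef
    have hk0 (y : ℝ) : 0 ≤ k y := mul_nonneg (by positivity) (fejerKernel_nonneg _)
    have hk : Integrable k := (integrable_fejerKernel.comp_mul_left' hl.ne').const_mul _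
    have hk1 : ∫ y, k y = 1 := by
      rw [hkdef, integral_const_mul, Measure.integral_comp_mul_left, abs_of_pos (inv_pos.mpr hl),
        smul_eq_mul, ← hc]
      field_simp
    have hin : 1 - η ≤ ∫ y in Icc (-η) η, k y := by
      have := integral_add_compl (measurableSet_Icc (a := -η) (b := η)) hk
      linarith
    have hgi (u : ℝ) : Integrable fun y ↦ g (u - y) * k y := by
      refine hk.bdd_mul (hg.comp (by fun_prop)).aestronglyMeasurable (c := M)
        (ae_of_all _ fun x ↦ ?_)
      rw [Real.norm_of_nonneg (hg0 _)]; exact hgM _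
    filter_upwards [(h l hl).eventually (lt_mem_nhds (show 1 - η < 1 by linarith)),
      (h l hl).eventually (gt_mem_nhds (show 1 < 1 + η by linarith))] with u hu1 hu2
    constructor
    · refine le_trans ?_ hu2.le
      calc _ ≤ g (u - η) * Real.exp (-(2 * η)) * ∫ y in Icc (-η) η, k y :=
            mul_le_mul_of_nonneg_left hin (mul_nonneg (hg0 _) (Real.exp_pos _).le)
        _ = ∫ y in Icc (-η) η, g (u - η) * Real.exp (-(2 * η)) * k y := by
            exact (integral_const_mul _ _).symm
        _ ≤ ∫ y in Icc (-η) η, g (u - y) * k y := by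
            refine setIntegral_mono_on (hk.const_mul _).integrableOn (hgi u).integrableOn
              measurableSet_Icc fun y hy ↦ mul_le_mul_of_nonneg_right ?_ (hk0 y)
            have h3 := hgle (show u - η ≤ u - y by linarith [hy.2])
            have h4 : Real.exp (u - y - (u - η)) ≤ Real.exp (2 * η) :=
              Real.exp_le_exp.mpr (by linarith [hy.1])
            rw [Real.exp_neg, ← div_eq_mul_inv, div_le_iff₀ (Real.exp_pos _)]
            exact h3.trans (mul_le_mul_of_nonneg_left h4 (hg0 _))
        _ ≤ ∫ y, g (u - y) * k y :=
            setIntegral_le_integral (hgi u) (ae_of_all _ fun y ↦ mul_nonneg (hg0 _) (hk0 y))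
    · refine hu1.le.trans ?_
      have hA : 0 ≤ g (u + η) * Real.exp (2 * η) := mul_nonneg (hg0 _) (Real.exp_pos _).le
      calc ∫ y, g (u - y) * k y
          ≤ ∫ y, (g (u + η) * Real.exp (2 * η) * k y +
              M * (Icc (-η) η)ᶜ.indicator k y) := by
            refine integral_mono (hgi u) ((hk.const_mul _).add
              ((hk.indicator measurableSet_Icc.compl).const_mul _)) fun y ↦ ?_
            by_cases hy : y ∈ Icc (-η) η
            · rw [indicator_of_notMem (by simpa using hy), mul_zero, add_zero]
              refine mul_le_mul_of_nonneg_right ?_ (hk0 y)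
              have h3 := hgle (show u - y ≤ u + η by linarith [hy.1])
              have h4 : Real.exp (u + η - (u - y)) ≤ Real.exp (2 * η) :=
                Real.exp_le_exp.mpr (by linarith [hy.2])
              exact h3.trans (mul_le_mul_of_nonneg_left h4 (hg0 _))
            · rw [indicator_of_mem (by simpa using hy)]
              have := mul_le_mul_of_nonneg_right (hgM (u - y)) (hk0 y)
              have := mul_nonneg hA (hk0 y)
              linarith
        _ = g (u + η) * Real.exp (2 * η) + M * ∫ y : ℝ in (Icc (-η) η)ᶜ, k y := by
            rw [integral_add (hk.const_mul _)
              ((hk.indicator measurableSet_Icc.compl).const_mul _),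
              integral_const_mul (μ := volume) _ k, integral_const_mul (μ := volume) M,
              integral_indicator measurableSet_Icc.compl, hk1, mul_one]
        _ ≤ _ := by
            have := mul_le_mul_of_nonneg_left htail.le hM0
            linarith
  rw [tendsto_order]
  constructor
  · intro a ha
    have hlim : Tendsto (fun η : ℝ ↦ (1 - η - M * η) * Real.exp (-(2 * η))) (𝓝[>] 0) (𝓝 1) := by
      have : Continuous fun η : ℝ ↦ (1 - η - M * η) * Real.exp (-(2 * η)) := by fun_prop
      simpa using (this.tendsto 0).mono_left (nhdsWithin_le_nhds (s := Ioi 0))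
    obtain ⟨η, hηa, hη⟩ := ((hlim.eventually (lt_mem_nhds ha)).and
      (Ioo_mem_nhdsGT (zero_lt_one' ℝ))).exists
    have := (tendsto_atTop_add_const_right atTop (-η) tendsto_id).eventually (main η hη.1 hη.2)
    filter_upwards [this] with u hu
    have h2 := hu.2
    simp only [id, neg_add_cancel_right] at h2
    refine hηa.trans_le ?_
    rw [Real.exp_neg, ← div_eq_mul_inv, div_le_iff₀ (Real.exp_pos _)]
    linarith
  · intro b hb
    have hlim : Tendsto (fun η : ℝ ↦ (1 + η) / (1 - η) * Real.exp (2 * η)) (𝓝[>] 0) (𝓝 1) := by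
      have : ContinuousAt (fun η : ℝ ↦ (1 + η) / (1 - η) * Real.exp (2 * η)) 0 := by
        refine ContinuousAt.mul (ContinuousAt.div (by fun_prop) (by fun_prop) (by norm_num))
          (by fun_prop)
      simpa using this.tendsto.mono_left (nhdsWithin_le_nhds (s := Ioi 0))
    obtain ⟨η, hηa, hη⟩ := ((hlim.eventually (gt_mem_nhds hb)).and
      (Ioo_mem_nhdsGT (zero_lt_one' ℝ))).exists
    have := (tendsto_atTop_add_const_right atTop η tendsto_id).eventually (main η hη.1 hη.2)
    filter_upwards [this] with u hu
    have h2 := hu.1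
    simp only [id, add_sub_cancel_right] at h2
    refine lt_of_le_of_lt ?_ hηa
    have h1η : 0 < 1 - η := by linarith [hη.2]
    rw [Real.exp_neg, ← div_eq_mul_inv, ← le_div_iff₀ h1η, div_le_iff₀ (Real.exp_pos _)] at h2
    exact h2

end

/-! ### The prime number theorem -/

section

open MeasureTheory Filter Set Topology

open Chebyshev ArithmeticFunction in
/-- The Laplace transform of `ψ (exp x) * exp (-x) - 1`, written through the function
`-ζ' / ζ (s) - 1 / (s - 1)`, which is continuous on `1 ≤ re s`. That function is the case of
modulus `1` of Mathlib's auxiliary function for residue classes, where the residue class is all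
of `ℕ`. -/
lemma psi_laplace_transform {s : ℂ} (hs : 0 < s.re) :
    ∫ x in Ioi (0 : ℝ), ((ψ (Real.exp x) * Real.exp (-x) - 1 : ℝ) : ℂ) * Complex.exp (-s * x) =
      (vonMangoldt.LFunctionResidueClassAux (1 : ZMod 1) (1 + s) - 1) / (1 + s) := by
  have hs1 : 1 < (1 + s).re := by simpa using hs
  have h1s : (1 + s) ≠ 0 := fun h ↦ by rw [h] at hs1; norm_num at hs1
  have hs0 : s ≠ 0 := fun h ↦ by rw [h] at hs; norm_num at hs
  have hL := vonMangoldt.eqOn_LFunctionResidueClassAux (q := 1) isUnit_one hs1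
  have hres : vonMangoldt.residueClass (1 : ZMod 1) = fun n ↦ Λ n := by
    ext n
    simp [vonMangoldt.residueClass, indicator, eq_iff_true_of_subsingleton]
  simp only [hres, Nat.totient_one, Nat.cast_one, inv_one, add_sub_cancel_left] at hL
  have hO : (fun n : ℕ ↦ ∑ k ∈ Finset.Icc 1 n, Λ k) =O[atTop] fun n ↦ (n : ℝ) ^ (1 : ℝ) := by
    refine Asymptotics.IsBigO.of_bound (Real.log 4 + 4) (Eventually.of_forall fun n ↦ ?_)
    have h1 := psi_le_const_mul_self (x := n) (by positivity)
    have h2 := psi_nonneg n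
    rw [psi, Nat.floor_natCast] at h1 h2
    rw [Real.rpow_one, show Finset.Icc 1 n = Finset.Ioc 0 n from rfl, Real.norm_of_nonneg h2,
      Real.norm_of_nonneg (by positivity)]
    exact h1
  have hint := LSeries_eq_mul_integral_of_nonneg (fun n ↦ Λ n) zero_le_one hs1 hO
    fun n ↦ vonMangoldt_nonneg
  have hcv : ∫ t in Ioi (1 : ℝ), (∑ k ∈ Finset.Icc 1 ⌊t⌋₊, (Λ k : ℂ)) * t ^ (-(1 + s + 1)) =
      ∫ x in Ioi (0 : ℝ), ((ψ (Real.exp x) * Real.exp (-x) : ℝ) : ℂ) * Complex.exp (-s * x) := by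
    rw [← Real.exp_zero, ← integral_comp_exp_Ioi]
    congr 1 with x
    have hx : (Real.exp x : ℂ) ≠ 0 := by exact_mod_cast (Real.exp_pos x).ne'
    rw [Complex.real_smul, psi, show Finset.Ioc 0 ⌊Real.exp x⌋₊ = Finset.Icc 1 ⌊Real.exp x⌋₊ from rfl,
      Complex.cpow_def_of_ne_zero hx, ← Complex.ofReal_log (Real.exp_pos x).le, Real.log_exp]
    push_cast
    have : Complex.exp x * Complex.exp (x * -(1 + s + 1)) =
        Complex.exp (-x) * Complex.exp (-s * x) := by
      rw [← Complex.exp_add, ← Complex.exp_add]; congr 1; ring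
    linear_combination (∑ k ∈ Finset.Icc 1 ⌊Real.exp x⌋₊, (Λ k : ℂ)) * this
  have hexp : IntegrableOn (fun x : ℝ ↦ Complex.exp (-s * x)) (Ioi 0) :=
    integrableOn_exp_mul_complex_Ioi (by simpa using hs) 0
  have hexpI : ∫ x : ℝ in Ioi 0, Complex.exp (-s * x) = 1 / s := by
    rw [integral_exp_mul_complex_Ioi (by simpa using hs)]
    simp
  have hmeas : Measurable fun x ↦ ψ (Real.exp x) * Real.exp (-x) :=
    (psi_mono.measurable.comp Real.measurable_exp).mul (by fun_prop)
  have hgi : IntegrableOn (fun x : ℝ ↦ ((ψ (Real.exp x) * Real.exp (-x) : ℝ) : ℂ) *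
      Complex.exp (-s * x)) (Ioi 0) := by
    refine Integrable.bdd_mul hexp (Complex.measurable_ofReal.comp hmeas).aestronglyMeasurable
      (c := Real.log 4 + 4) (ae_of_all _ fun x ↦ ?_)
    rw [Complex.norm_real, Real.norm_of_nonneg (mul_nonneg (psi_nonneg _) (Real.exp_pos _).le),
      Real.exp_neg, ← div_eq_mul_inv, div_le_iff₀ (Real.exp_pos x)]
    exact psi_le_const_mul_self (Real.exp_pos x).le
  have hsplit : ∫ x in Ioi (0 : ℝ), ((ψ (Real.exp x) * Real.exp (-x) - 1 : ℝ) : ℂ) *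
      Complex.exp (-s * x) =
      (∫ x in Ioi (0 : ℝ), ((ψ (Real.exp x) * Real.exp (-x) : ℝ) : ℂ) * Complex.exp (-s * x)) -
        1 / s := by
    rw [← hexpI, ← integral_sub hgi hexp]
    congr 1 with x
    push_cast
    ring
  rw [hsplit, ← hcv, hL, hint]
  field_simp
  ring

open Chebyshev ArithmeticFunction in
/-- The **prime number theorem** for `ψ`. -/
theorem tendsto_psi_div_atTop : Tendsto (fun x ↦ ψ x / x) atTop (𝓝 1) := by
  have hmeas : Measurable fun x ↦ ψ (Real.exp x) * Real.exp (-x) :=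
    (psi_mono.measurable.comp Real.measurable_exp).mul (by fun_prop)
  have h0 (x : ℝ) : 0 ≤ ψ (Real.exp x) * Real.exp (-x) :=
    mul_nonneg (psi_nonneg _) (Real.exp_pos _).le
  have hM (x : ℝ) : ψ (Real.exp x) * Real.exp (-x) ≤ Real.log 4 + 4 := by
    rw [Real.exp_neg, ← div_eq_mul_inv, div_le_iff₀ (Real.exp_pos x)]
    exact psi_le_const_mul_self (Real.exp_pos x).le
  have hlim : Tendsto (fun x ↦ ψ (Real.exp x) * Real.exp (-x)) atTop (𝓝 1) := by
    refine tendsto_one_of_tendsto_convolution hmeas h0 hM ?_ fun l hl ↦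
      tendsto_convolution_fejerKernel hmeas h0 hM (fun x hx ↦ ?_) hl ?_
    · have : (fun x ↦ ψ (Real.exp x) * Real.exp (-x) * Real.exp x) = fun x ↦ ψ (Real.exp x) := by
        ext x
        rw [mul_assoc, ← Real.exp_add, neg_add_cancel, Real.exp_zero, mul_one]
      rw [this]
      exact psi_mono.comp Real.exp_monotone
    · rw [psi_eq_zero_of_le_one (Real.exp_le_one_iff.mpr hx), zero_mul]
    · refine tendsto_integral_mul_fejerKernel (M := Real.log 4 + 4 + 1) (hmeas.sub_const 1)
        (fun x ↦ ?_) (F := fun s ↦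
          (vonMangoldt.LFunctionResidueClassAux (1 : ZMod 1) (1 + s) - 1) / (1 + s)) ?_
        (fun s hs ↦ (psi_laplace_transform hs).symm) hl
      · rw [abs_le]
        have := h0 x; have := hM x; have : 0 ≤ Real.log 4 := Real.log_nonneg (by norm_num)
        constructor <;> linarith
      · have hc := (vonMangoldt.continuousOn_LFunctionResidueClassAux (1 : ZMod 1)).comp
          (f := fun s : ℂ ↦ 1 + s) (s := {s : ℂ | 0 ≤ s.re}) (by fun_prop) (fun s hs ↦ by
            simpa using hs)
        refine (hc.sub continuousOn_const).div (by fun_prop) fun s hs h ↦ ?_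
        have := congrArg Complex.re h
        simp only [Complex.add_re, Complex.one_re, Complex.zero_re] at this
        have : 0 ≤ s.re := hs
        linarith
  refine (hlim.comp Real.tendsto_log_atTop).congr' ?_
  filter_upwards [eventually_gt_atTop 0] with x hx
  simp only [Function.comp_apply, Real.exp_log hx, Real.exp_neg]
  rfl

open Chebyshev in
theorem tendsto_theta_div_atTop : Tendsto (fun x ↦ θ x / x) atTop (𝓝 1) := by
  have h : Tendsto (fun x ↦ (ψ x - θ x) / x) atTop (𝓝 0) := by
    have h1 : (ψ - θ) =o[atTop] fun x : ℝ ↦ x := by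
      refine isBigO_psi_sub_theta_sqrt.trans_isLittleO ?_
      refine (Asymptotics.isLittleO_iff_tendsto' ?_).mpr ?_
      · filter_upwards [eventually_gt_atTop 0] with x hx h using absurd h hx.ne'
      · refine (tendsto_inv_atTop_zero.comp Real.tendsto_sqrt_atTop).congr fun x ↦ ?_
        rw [Real.sqrt_div_self]
        rfl
    exact h1.tendsto_div_nhds_zero
  have := tendsto_psi_div_atTop.sub h
  rw [sub_zero] at this
  exact this.congr fun x ↦ by ring

open Chebyshev in
/-- The lower bound of the prime number theorem for the primes in `(N, 2 * N]`. -/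
theorem eventually_le_card_primes_Ioc {ε : ℝ} (hε : 0 < ε) :
    ∀ᶠ N : ℝ in atTop, (1 - ε) * (N / Real.log N) ≤
      (((Finset.Ioc ⌊N⌋₊ ⌊2 * N⌋₊).filter Nat.Prime).card : ℝ) := by
  have h1 : Tendsto (fun N : ℝ ↦ (θ (2 * N) - θ N) / N) atTop (𝓝 1) := by
    have h2 := (tendsto_theta_div_atTop.comp
      (tendsto_id.const_mul_atTop (show (0 : ℝ) < 2 by norm_num))).const_mul 2
    have := h2.sub tendsto_theta_div_atTop
    norm_num at this
    refine this.congr' ?_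
    filter_upwards [eventually_gt_atTop 0] with N hN
    field_simp
  have h3 : Tendsto (fun N : ℝ ↦ Real.log N / Real.log (2 * N)) atTop (𝓝 1) := by
    have h4 : Tendsto (fun N : ℝ ↦ 1 / (1 + Real.log 2 / Real.log N)) atTop (𝓝 1) := by
      have := (tendsto_const_nhds (x := Real.log 2)).div_atTop Real.tendsto_log_atTop
      have := (this.const_add 1).inv₀ (by norm_num)
      simpa using this
    refine h4.congr' ?_
    filter_upwards [eventually_gt_atTop 1] with N hN
    have : 0 < Real.log N := Real.log_pos hN
    rw [Real.log_mul (by norm_num) (by linarith)]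
    field_simp
    ring
  have h5 := h1.mul h3
  rw [mul_one] at h5
  filter_upwards [h5.eventually (lt_mem_nhds (show 1 - ε < 1 by linarith)),
    eventually_gt_atTop 1] with N hN hN1
  have hlog : 0 < Real.log N := Real.log_pos hN1
  have hlog2 : 0 < Real.log (2 * N) := Real.log_pos (by linarith)
  have hle : ⌊N⌋₊ ≤ ⌊2 * N⌋₊ := Nat.floor_mono (by linarith)
  have hsum : θ (2 * N) - θ N = ∑ p ∈ (Finset.Ioc ⌊N⌋₊ ⌊2 * N⌋₊).filter Nat.Prime, Real.log p := by
    rw [theta, theta, Finset.sum_filter, Finset.sum_filter, Finset.sum_filter,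
      ← Finset.sum_Ioc_consecutive _ (Nat.zero_le _) hle]
    ring
  have hcard : θ (2 * N) - θ N ≤
      (((Finset.Ioc ⌊N⌋₊ ⌊2 * N⌋₊).filter Nat.Prime).card : ℝ) * Real.log (2 * N) := by
    rw [hsum, ← nsmul_eq_mul]
    refine Finset.sum_le_card_nsmul _ _ _ fun p hp ↦ ?_
    simp only [Finset.mem_filter, Finset.mem_Ioc] at hp
    have hp2 : (p : ℝ) ≤ 2 * N := (Nat.le_floor_iff (by linarith)).mp hp.1.2
    exact Real.log_le_log (by exact_mod_cast hp.2.pos) hp2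
  calc (1 - ε) * (N / Real.log N)
      ≤ (θ (2 * N) - θ N) / N * (Real.log N / Real.log (2 * N)) * (N / Real.log N) :=
        mul_le_mul_of_nonneg_right hN.le (by positivity)
    _ = (θ (2 * N) - θ N) / Real.log (2 * N) := by field_simp
    _ ≤ _ := by rwa [div_le_iff₀ hlog2]

end

/-! ### Selberg's sieve for primes in an interval -/

section

open Finset ArithmeticFunction
open scoped ArithmeticFunction.Moebius

/-- The Selberg sieve problem of sifting the integers in `(a, a + m]` by the primes `p ≤ R`,
with density `ν d = 1 / d`. -/
noncomputable def intervalSieve (a m R : ℕ) : BoundingSieve where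
  support := Ioc a (a + m)
  prodPrimes := primorial R
  prodPrimes_squarefree := squarefree_primorial R
  weights := fun _ ↦ 1
  weights_nonneg := fun _ ↦ zero_le_one
  totalMass := m
  nu := ⟨fun d ↦ (d : ℝ)⁻¹, by simp⟩
  nu_mult := ⟨by simp, fun {m n} _ ↦ by simp [mul_comm]⟩
  nu_pos_of_prime := fun p hp _ ↦ by
    have := hp.pos
    simpa using this
  nu_lt_one_of_prime := fun p hp _ ↦ by
    have : (1 : ℝ) < p := by exact_mod_cast hp.one_lt
    simpa using inv_lt_one_of_one_lt₀ this

lemma intervalSieve_nu (a m R d : ℕ) : (intervalSieve a m R).nu d = (d : ℝ)⁻¹ := rfl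

lemma abs_intervalSieve_rem_le (a m R : ℕ) {d : ℕ} (hd : 0 < d) :
    |(intervalSieve a m R).rem d| ≤ 1 := by
  have hmult : (intervalSieve a m R).multSum d = (((a + m) / d : ℕ) : ℝ) - ((a / d : ℕ) : ℝ) := by
    have h1 : (intervalSieve a m R).multSum d = #{n ∈ Ioc a (a + m) | d ∣ n} := by
      simp [BoundingSieve.multSum, intervalSieve]
    have h2 : #{n ∈ Ioc 0 a | d ∣ n} + #{n ∈ Ioc a (a + m) | d ∣ n} =
        #{n ∈ Ioc 0 (a + m) | d ∣ n} := by
      simp only [card_filter]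
      exact sum_Ioc_consecutive _ (Nat.zero_le _) (Nat.le_add_right _ _)
    rw [Nat.Ioc_filter_dvd_card_eq_div, Nat.Ioc_filter_dvd_card_eq_div] at h2
    rw [h1, ← h2]
    push_cast
    ring
  have htot : (intervalSieve a m R).totalMass = m := rfl
  rw [BoundingSieve.rem, hmult, htot, intervalSieve_nu, abs_le]
  have hd' : (0 : ℝ) < d := by exact_mod_cast hd
  have e1 := Nat.cast_div_le (α := ℝ) (m := a + m) (n := d)
  have e2 := Nat.cast_div_le (α := ℝ) (m := a) (n := d)
  have e3 : ((a + m : ℕ) : ℝ) / d < ((a + m) / d : ℕ) + 1 := by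
    rw [div_lt_iff₀' hd']
    exact_mod_cast Nat.lt_mul_div_succ (a + m) hd
  have e4 : (a : ℝ) / d < (a / d : ℕ) + 1 := by
    rw [div_lt_iff₀' hd']
    exact_mod_cast Nat.lt_mul_div_succ a hd
  have e5 : ((a + m : ℕ) : ℝ) / d = (a : ℝ) / d + (d : ℝ)⁻¹ * m := by
    push_cast; field_simp
  rw [e5] at e1 e3
  constructor <;> linarith

lemma sum_divisors_moebius (n : ℕ) :
    ∑ d ∈ n.divisors, ((μ d : ℤ) : ℝ) = if n = 1 then 1 else 0 := by
  have := congrArg (fun f : ArithmeticFunction ℤ ↦ f n) moebius_mul_coe_zeta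
  simp only [coe_mul_zeta_apply, one_apply] at this
  exact_mod_cast this

/-- Möbius inversion over the divisors of the squarefree number `k` that are multiples of `l`. -/
lemma sum_moebius_between {P k l : ℕ} (hP : P ≠ 0) (hk : k ∣ P) (hks : Squarefree k) :
    ∑ d ∈ P.divisors, (if l ∣ d ∧ d ∣ k then ((μ d : ℤ) : ℝ) else 0) =
      if l = k then ((μ l : ℤ) : ℝ) else 0 := by
  by_cases hlk : l ∣ k
  · obtain ⟨e, rfl⟩ := hlk
    have hl0 : l ≠ 0 := fun h ↦ by simp [h] at hks
    have he0 : e ≠ 0 := fun h ↦ by simp [h] at hks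
    have himage : P.divisors.filter (fun d ↦ l ∣ d ∧ d ∣ l * e) = e.divisors.image (l * ·) := by
      ext d
      simp only [mem_filter, Nat.mem_divisors, mem_image]
      constructor
      · rintro ⟨-, ⟨f, rfl⟩, h⟩
        exact ⟨f, ⟨Nat.dvd_of_mul_dvd_mul_left (Nat.pos_of_ne_zero hl0) h, he0⟩, rfl⟩
      · rintro ⟨f, ⟨hf, -⟩, rfl⟩
        have := Nat.mul_dvd_mul_left l hf
        exact ⟨⟨this.trans hk, hP⟩, Nat.dvd_mul_right _ _, this⟩
    rw [← sum_filter, himage, sum_image (fun x _ y _ h ↦ Nat.eq_of_mul_eq_mul_left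
      (Nat.pos_of_ne_zero hl0) h)]
    have hmul : ∀ f ∈ e.divisors, ((μ (l * f) : ℤ) : ℝ) = (μ l : ℤ) * ((μ f : ℤ) : ℝ) := by
      intro f hf
      have hcop : l.Coprime f := (Nat.coprime_of_squarefree_mul hks).coprime_dvd_right
        (Nat.dvd_of_mem_divisors hf)
      rw [isMultiplicative_moebius.map_mul_of_coprime hcop]
      push_cast; rfl
    rw [sum_congr rfl hmul, ← mul_sum, sum_divisors_moebius e]
    have : l = l * e ↔ e = 1 := by
      rw [eq_comm, Nat.mul_eq_left hl0]
    simp [this]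
  · rw [if_neg (fun h : l = k ↦ hlk (h ▸ dvd_rfl)), sum_eq_zero]
    intro d _
    rw [if_neg]
    exact fun h ↦ hlk (h.1.trans h.2)

/-- The sum `S = ∑ g l` over the `l ≤ R` composed of sifting primes, where `g` is the multiplicative
function `l ↦ 1 / φ l` on squarefree numbers. The main term of the sieve is `m / S`. -/
noncomputable def selbergSum (a m R : ℕ) : ℝ :=
  ∑ l ∈ (primorial R).divisors with l ≤ R, (intervalSieve a m R).selbergTerms l

/-- Selberg's weights of level `R`: they minimise the main term of the `Λ²` sieve among the weights
supported on `d ≤ R` with value `1` at `1`. -/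
noncomputable def selbergWeight (a m R d : ℕ) : ℝ :=
  d * (μ d : ℤ) * (∑ l ∈ (primorial R).divisors with l ≤ R,
    if d ∣ l then (intervalSieve a m R).selbergTerms l else 0) / selbergSum a m R

lemma selbergTerms_intervalSieve_pos (a m : ℕ) {R l : ℕ} (hl : l ∈ (primorial R).divisors) :
    0 < (intervalSieve a m R).selbergTerms l :=
  BoundingSieve.selbergTerms_pos (Nat.dvd_of_mem_divisors hl)

lemma selbergSum_pos (a m : ℕ) {R : ℕ} (hR : 1 ≤ R) : 0 < selbergSum a m R := by
  refine sum_pos (fun l hl ↦ selbergTerms_intervalSieve_pos a m (mem_filter.mp hl).1) ⟨1, ?_⟩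
  simp [hR, primorial_ne_zero]

lemma selbergWeight_one (a m : ℕ) {R : ℕ} (hR : 1 ≤ R) : selbergWeight a m R 1 = 1 := by
  have := (selbergSum_pos a m hR).ne'
  simp only [selbergWeight, Nat.cast_one, moebius_apply_one, Int.cast_one, one_mul, one_dvd, if_true]
  exact div_self this

/-- In fact `|selbergWeight a m R d| ≤ 1`; this cruder bound only costs powers of `R` in the error
term, which is harmless when `R` is a small power of the length of the interval. -/
lemma abs_selbergWeight_le (a m : ℕ) {R : ℕ} (hR : 1 ≤ R) (d : ℕ) :
    |selbergWeight a m R d| ≤ d := by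
  have hS := selbergSum_pos a m hR
  have hnn : 0 ≤ ∑ l ∈ (primorial R).divisors with l ≤ R,
      if d ∣ l then (intervalSieve a m R).selbergTerms l else 0 :=
    sum_nonneg fun l hl ↦ by
      split_ifs
      exacts [(selbergTerms_intervalSieve_pos a m (mem_filter.mp hl).1).le, le_rfl]
  have hle : ∑ l ∈ (primorial R).divisors with l ≤ R,
      (if d ∣ l then (intervalSieve a m R).selbergTerms l else 0) ≤ selbergSum a m R :=
    sum_le_sum fun l hl ↦ by
      split_ifs
      exacts [le_rfl, (selbergTerms_intervalSieve_pos a m (mem_filter.mp hl).1).le]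
  have hmu : |(((μ d : ℤ)) : ℝ)| ≤ 1 := by exact_mod_cast abs_moebius_le_one
  rw [selbergWeight, abs_div, abs_mul, abs_mul, Nat.abs_cast, abs_of_pos hS, abs_of_nonneg hnn,
    div_le_iff₀ hS]
  have h1 : (d : ℝ) * |((μ d : ℤ) : ℝ)| ≤ d := mul_le_of_le_one_right (Nat.cast_nonneg d) hmu
  exact mul_le_mul h1 hle hnn (Nat.cast_nonneg d)

lemma selbergWeight_eq_zero (a m : ℕ) {R d : ℕ} (hd : R < d) : selbergWeight a m R d = 0 := by
  have : ∑ l ∈ (primorial R).divisors with l ≤ R,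
      (if d ∣ l then (intervalSieve a m R).selbergTerms l else 0) = 0 := by
    refine sum_eq_zero fun l hl ↦ if_neg fun h ↦ ?_
    rw [mem_filter] at hl
    have := Nat.le_of_dvd (Nat.pos_of_mem_divisors hl.1) h
    omega
  rw [selbergWeight, this, mul_zero, zero_div]

lemma mainSum_selbergWeight (a m : ℕ) {R : ℕ} (hR : 1 ≤ R) :
    (intervalSieve a m R).mainSum (BoundingSieve.lambdaSquared (selbergWeight a m R)) =
      (selbergSum a m R)⁻¹ := by
  have hS := selbergSum_pos a m hR
  set S := selbergSum a m R with hSdef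
  set s := intervalSieve a m R with hs
  have hP : s.prodPrimes = primorial R := rfl
  have hP0 := primorial_ne_zero R
  -- the diagonalising variables of the quadratic form
  have hY : ∀ l ∈ (primorial R).divisors,
      (∑ d ∈ (primorial R).divisors, if l ∣ d then s.nu d * selbergWeight a m R d else 0) =
        if l ≤ R then (μ l : ℤ) * s.selbergTerms l / S else 0 := by
    intro l hl
    have e1 : ∀ d ∈ (primorial R).divisors,
        (if l ∣ d then s.nu d * selbergWeight a m R d else 0) =
        ∑ k ∈ (primorial R).divisors with k ≤ R,
          (s.selbergTerms k / S) * (if l ∣ d ∧ d ∣ k then ((μ d : ℤ) : ℝ) else 0) := by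
      intro d hd
      have hd0 : (d : ℝ) ≠ 0 := by exact_mod_cast (Nat.pos_of_mem_divisors hd).ne'
      by_cases hld : l ∣ d
      · simp only [hld, if_true, true_and]
        rw [hs, intervalSieve_nu, selbergWeight, ← hSdef, mul_sum, sum_div, mul_sum]
        refine sum_congr rfl fun k _ ↦ ?_
        split_ifs
        · field_simp
        · simp
      · simp [hld]
    rw [sum_congr rfl e1, sum_comm]
    have e2 : ∀ k ∈ (primorial R).divisors.filter (· ≤ R),
        (∑ d ∈ (primorial R).divisors,
          (s.selbergTerms k / S) * (if l ∣ d ∧ d ∣ k then ((μ d : ℤ) : ℝ) else 0)) =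
        if l = k then (μ l : ℤ) * s.selbergTerms l / S else 0 := by
      intro k hk
      have hkP := Nat.dvd_of_mem_divisors (mem_filter.mp hk).1
      rw [← mul_sum, sum_moebius_between hP0 hkP
        ((squarefree_primorial R).squarefree_of_dvd hkP)]
      split_ifs with h
      · rw [h]; ring
      · simp
    rw [sum_congr rfl e2, sum_ite_eq]
    simp [hl]
  rw [BoundingSieve.mainSum_lambdaSquared_eq_sum_mul_sum_sq, hP]
  have e3 : ∀ l ∈ (primorial R).divisors, (s.selbergTerms l)⁻¹ *
      (∑ d ∈ (primorial R).divisors, if l ∣ d then s.nu d * selbergWeight a m R d else 0) ^ 2 =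
      if l ≤ R then s.selbergTerms l / S ^ 2 else 0 := by
    intro l hl
    rw [hY l hl]
    have hg := (selbergTerms_intervalSieve_pos a m hl).ne'
    rw [← hs] at hg
    split_ifs
    · have hmu : (((μ l : ℤ)) : ℝ) ^ 2 = 1 := by
        have := moebius_sq_eq_one_of_squarefree
          ((squarefree_primorial R).squarefree_of_dvd (Nat.dvd_of_mem_divisors hl))
        exact_mod_cast this
      rw [div_pow, mul_pow, hmu]
      field_simp
    · simp
  rw [sum_congr rfl e3, ← sum_filter, ← sum_div]
  change S / S ^ 2 = S⁻¹
  field_simp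

lemma errSum_selbergWeight_le (a m : ℕ) {R : ℕ} (hR : 1 ≤ R) :
    (intervalSieve a m R).errSum (BoundingSieve.lambdaSquared (selbergWeight a m R)) ≤
      (R : ℝ) ^ 4 := by
  set w := selbergWeight a m R with hw
  have hP0 := primorial_ne_zero R
  have hsub (d : ℕ) (hd : d ∈ (primorial R).divisors) : d.divisors ⊆ (primorial R).divisors :=
    Nat.divisors_subset_of_dvd hP0 (Nat.dvd_of_mem_divisors hd)
  have hw1 : ∑ d ∈ (primorial R).divisors, |w d| ≤ (R : ℝ) ^ 2 := by
    calc ∑ d ∈ (primorial R).divisors, |w d|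
        = ∑ d ∈ (primorial R).divisors with d ≤ R, |w d| := by
          rw [sum_filter]
          refine sum_congr rfl fun d _ ↦ ?_
          split_ifs with h
          · rfl
          · rw [hw, selbergWeight_eq_zero a m (not_le.mp h), abs_zero]
      _ ≤ ∑ d ∈ Icc 1 R, |w d| := by
          refine sum_le_sum_of_subset_of_nonneg (fun d hd ↦ ?_) fun _ _ _ ↦ abs_nonneg _
          rw [mem_filter] at hd
          exact mem_Icc.mpr ⟨Nat.pos_of_mem_divisors hd.1, hd.2⟩
      _ ≤ ∑ d ∈ Icc 1 R, (R : ℝ) := sum_le_sum fun d hd ↦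
          (abs_selbergWeight_le a m hR d).trans (by exact_mod_cast (mem_Icc.mp hd).2)
      _ = (R : ℝ) ^ 2 := by simp [sq]
  have hlam (d : ℕ) (hd : d ∈ (primorial R).divisors) :
      |BoundingSieve.lambdaSquared w d| * |(intervalSieve a m R).rem d| ≤
        ∑ d1 ∈ (primorial R).divisors, ∑ d2 ∈ (primorial R).divisors,
          if d = Nat.lcm d1 d2 then |w d1| * |w d2| else 0 := by
    have hnn (d1 d2 : ℕ) : 0 ≤ if d = Nat.lcm d1 d2 then |w d1| * |w d2| else 0 := by
      split_ifs <;> positivity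
    calc _ ≤ |BoundingSieve.lambdaSquared w d| * 1 :=
          mul_le_mul_of_nonneg_left (abs_intervalSieve_rem_le a m R (Nat.pos_of_mem_divisors hd))
            (abs_nonneg _)
      _ ≤ ∑ d1 ∈ d.divisors, ∑ d2 ∈ d.divisors,
          if d = Nat.lcm d1 d2 then |w d1| * |w d2| else 0 := by
          rw [mul_one, BoundingSieve.lambdaSquared]
          refine (abs_sum_le_sum_abs _ _).trans (sum_le_sum fun d1 _ ↦
            (abs_sum_le_sum_abs _ _).trans (sum_le_sum fun d2 _ ↦ ?_))
          split_ifs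
          · rw [abs_mul]
          · simp
      _ ≤ ∑ d1 ∈ d.divisors, ∑ d2 ∈ (primorial R).divisors,
          if d = Nat.lcm d1 d2 then |w d1| * |w d2| else 0 :=
          sum_le_sum fun d1 _ ↦ sum_le_sum_of_subset_of_nonneg (hsub d hd) fun _ _ _ ↦ hnn _ _
      _ ≤ _ := sum_le_sum_of_subset_of_nonneg (hsub d hd) fun _ _ _ ↦
          sum_nonneg fun _ _ ↦ hnn _ _
  calc (intervalSieve a m R).errSum (BoundingSieve.lambdaSquared w)
      ≤ ∑ d ∈ (primorial R).divisors, ∑ d1 ∈ (primorial R).divisors,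
          ∑ d2 ∈ (primorial R).divisors, (if d = Nat.lcm d1 d2 then |w d1| * |w d2| else 0) :=
        sum_le_sum hlam
    _ = ∑ d1 ∈ (primorial R).divisors, ∑ d2 ∈ (primorial R).divisors,
          ∑ d ∈ (primorial R).divisors, (if d = Nat.lcm d1 d2 then |w d1| * |w d2| else 0) := by
        rw [sum_comm]
        exact sum_congr rfl fun _ _ ↦ sum_comm
    _ ≤ ∑ d1 ∈ (primorial R).divisors, ∑ d2 ∈ (primorial R).divisors, |w d1| * |w d2| := by
        refine sum_le_sum fun d1 _ ↦ sum_le_sum fun d2 _ ↦ ?_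
        rw [sum_ite_eq']
        split_ifs <;> first | exact le_rfl | positivity
    _ = (∑ d ∈ (primorial R).divisors, |w d|) ^ 2 := by rw [sq, sum_mul_sum]
    _ ≤ ((R : ℝ) ^ 2) ^ 2 := by
        gcongr
    _ = (R : ℝ) ^ 4 := by ring

lemma sum_inv_sq_le_two (R : ℕ) : ∑ b ∈ Icc 1 R, ((b : ℝ) ^ 2)⁻¹ ≤ 2 := by
  have h := sum_Ioo_inv_sq_le (α := ℝ) 0 (R + 1)
  have : Ioo 0 (R + 1) = Icc 1 R := by ext; simp; omega
  rw [this] at h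
  simpa using h

/-- Writing `n = b ^ 2 * c` with `c` squarefree bounds the harmonic sum up to `R` by `∑ 1 / b ^ 2`
times the sum of `1 / c` over squarefree `c ≤ R`, and `1 / c ≤ g c`. -/
lemma log_le_two_mul_selbergSum (a m R : ℕ) : Real.log R ≤ 2 * selbergSum a m R := by
  set D := (primorial R).divisors.filter (· ≤ R) with hD
  have hS : ∑ l ∈ D, (l : ℝ)⁻¹ ≤ selbergSum a m R := by
    refine sum_le_sum fun l hl ↦ ?_
    rw [BoundingSieve.selbergTerms_apply, intervalSieve_nu]
    refine le_mul_of_one_le_right (by positivity) (one_le_prod fun p hp ↦ ?_)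
    rw [intervalSieve_nu]
    have hp1 : (1 : ℝ) < p := by exact_mod_cast (Nat.prime_of_mem_primeFactors hp).one_lt
    exact (one_le_inv₀ (by linarith [inv_lt_one_of_one_lt₀ hp1])).mpr
      (by linarith [inv_pos.mpr (zero_lt_one.trans hp1)])
  choose! c b hcb hc using fun n : ℕ ↦ Nat.sq_mul_squarefree n
  have hharm : Real.log R ≤ ∑ n ∈ Icc 1 R, (n : ℝ)⁻¹ := by
    have h1 := log_add_one_le_harmonic R
    rw [harmonic_eq_sum_Icc] at h1
    push_cast at h1
    rcases Nat.eq_zero_or_pos R with rfl | hR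
    · simp
    · exact (Real.log_le_log (by exact_mod_cast hR) (by linarith)).trans h1
  have hmain : ∑ n ∈ Icc 1 R, (n : ℝ)⁻¹ ≤
      (∑ l ∈ D, (l : ℝ)⁻¹) * ∑ b ∈ Icc 1 R, ((b : ℝ) ^ 2)⁻¹ := by
    rw [sum_mul_sum, ← sum_product']
    have hinj : Set.InjOn (fun n ↦ (c n, b n)) (Icc 1 R) := by
      intro x _ y _ h
      simp only [Prod.mk.injEq] at h
      rw [← hcb x, ← hcb y, h.1, h.2]
    calc ∑ n ∈ Icc 1 R, (n : ℝ)⁻¹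
        = ∑ n ∈ Icc 1 R, ((c n : ℝ)⁻¹ * ((b n : ℝ) ^ 2)⁻¹) := by
          refine sum_congr rfl fun n _ ↦ ?_
          conv_lhs => rw [← hcb n]
          push_cast
          rw [mul_inv, mul_comm]
      _ = ∑ x ∈ (Icc 1 R).image (fun n ↦ (c n, b n)), ((x.1 : ℝ)⁻¹ * ((x.2 : ℝ) ^ 2)⁻¹) := by
          rw [sum_image hinj]
      _ ≤ _ := by
          refine sum_le_sum_of_subset_of_nonneg ?_ fun _ _ _ ↦ by positivity
          intro x hx
          obtain ⟨n, hn, rfl⟩ := mem_image.mp hx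
          rw [mem_Icc] at hn
          have hcn0 : 0 < c n := Nat.pos_of_ne_zero (hc n).ne_zero
          have hbn0 : 0 < b n := Nat.pos_of_ne_zero fun h ↦ by
            have := hcb n; rw [h] at this; simp at this; omega
          have hcn : c n ≤ n := Nat.le_of_dvd hn.1 ⟨b n ^ 2, by rw [mul_comm, hcb]⟩
          have hbn : b n ≤ n := by
            have : b n ∣ n := ⟨b n * c n, by rw [← mul_assoc, ← sq, hcb]⟩
            exact Nat.le_of_dvd hn.1 this
          rw [mem_product, hD, mem_filter, Nat.mem_divisors, mem_Icc]
          exact ⟨⟨⟨(hc n).dvd_primorial.trans (primorial_dvd_primorial (hcn.trans hn.2)),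
            primorial_ne_zero R⟩, hcn.trans hn.2⟩, hbn0, hbn.trans hn.2⟩
  have hS0 : 0 ≤ ∑ l ∈ D, (l : ℝ)⁻¹ := sum_nonneg fun _ _ ↦ by positivity
  calc Real.log R ≤ _ := hharm
    _ ≤ _ := hmain
    _ ≤ (∑ l ∈ D, (l : ℝ)⁻¹) * 2 := mul_le_mul_of_nonneg_left (sum_inv_sq_le_two R) hS0
    _ ≤ _ := by linarith

lemma card_primes_le_siftedSum_add (a m R : ℕ) :
    (((Ioc a (a + m)).filter Nat.Prime).card : ℝ) ≤ (intervalSieve a m R).siftedSum + R := by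
  have h1 : (intervalSieve a m R).siftedSum =
      #{d ∈ Ioc a (a + m) | Nat.Coprime (primorial R) d} := by
    rw [BoundingSieve.siftedSum, card_filter]
    push_cast
    rfl
  have h2 : (Ioc a (a + m)).filter Nat.Prime ⊆
      {d ∈ Ioc a (a + m) | Nat.Coprime (primorial R) d} ∪ Icc 1 R := by
    intro p hp
    rw [mem_filter] at hp
    rw [mem_union, mem_filter, mem_Icc]
    rcases le_or_gt p R with h | h
    · exact Or.inr ⟨hp.2.pos, h⟩
    · refine Or.inl ⟨hp.1, ?_⟩
      rw [Nat.coprime_comm, hp.2.coprime_iff_not_dvd, hp.2.dvd_primorial_iff]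
      omega
  have h3 := (card_le_card h2).trans (card_union_le _ _)
  rw [Nat.card_Icc, Nat.add_sub_cancel] at h3
  rw [h1]
  exact_mod_cast h3

/-- The Selberg sieve bound of level `R` for the number of primes in an interval of length `m`. -/
theorem card_primes_Ioc_le (a m : ℕ) {R : ℕ} (hR : 2 ≤ R) :
    (((Ioc a (a + m)).filter Nat.Prime).card : ℝ) ≤ 2 * m / Real.log R + R ^ 4 + R := by
  have hR1 : 1 ≤ R := by omega
  have h1 := card_primes_le_siftedSum_add a m R
  have h2 := BoundingSieve.siftedSum_le_mainSum_errSum_of_upperMoebius (s := intervalSieve a m R) _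
    (BoundingSieve.upperMoebius_lambdaSquared _ (selbergWeight_one a m hR1))
  rw [mainSum_selbergWeight a m hR1, show (intervalSieve a m R).totalMass = m from rfl] at h2
  have h3 := errSum_selbergWeight_le a m hR1
  have hlog : 0 < Real.log R := Real.log_pos (by exact_mod_cast hR)
  have h4 : (m : ℝ) * (selbergSum a m R)⁻¹ ≤ 2 * m / Real.log R := by
    rw [← div_eq_mul_inv, div_le_div_iff₀ (selbergSum_pos a m hR1) hlog]
    have := mul_le_mul_of_nonneg_left (log_le_two_mul_selbergSum a m R) (Nat.cast_nonneg (α := ℝ) m)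
    linarith
  linarith

end

/-! ### Primes near the zeros of a cosine -/

open Filter Finset

/-- A Brun-Titchmarsh inequality, uniform in the position of the interval. -/
lemma eventually_card_primes_le : ∀ᶠ h : ℝ in atTop, ∀ (a : ℕ) (s : Finset ℕ),
    (∀ p ∈ s, p.Prime ∧ a ≤ p ∧ (p : ℝ) ≤ a + h) → (s.card : ℝ) ≤ 33 * (h / Real.log h) := by
  have hlo := (isLittleO_log_rpow_atTop (show (0 : ℝ) < 1 / 2 by norm_num)).bound
    (show (0 : ℝ) < 1 / 3 by norm_num)
  filter_upwards [eventually_ge_atTop ((2 : ℝ) ^ 16), hlo] with h hh hlog a s hs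
  have h1 : (1 : ℝ) < h := lt_of_lt_of_le (by norm_num) hh
  have h0 : (0 : ℝ) < h := by linarith
  have hlogpos : 0 < Real.log h := Real.log_pos h1
  set y : ℝ := h ^ (1 / 16 : ℝ) with hy
  have hy16 : y ^ 16 = h := by
    rw [hy, ← Real.rpow_natCast, ← Real.rpow_mul h0.le]; norm_num
  have hy0 : 0 < y := Real.rpow_pos_of_pos h0 _
  have hy2 : 2 ≤ y := by
    rw [← hy16] at hh
    exact le_of_pow_le_pow_left₀ (by norm_num) hy0.le hh
  have hy8 : h ^ (1 / 2 : ℝ) = y ^ 8 := by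
    rw [hy, ← Real.rpow_natCast, ← Real.rpow_mul h0.le]; norm_num
  have hlogy : Real.log h = 16 * Real.log y := by
    rw [← hy16, Real.log_pow]; norm_num
  rw [hy8, Real.norm_of_nonneg hlogpos.le, Real.norm_of_nonneg (by positivity)] at hlog
  -- sieve up to level `h ^ (1 / 8)`
  set R := ⌊y ^ 2⌋₊ with hR
  have hRle : (R : ℝ) ≤ y ^ 2 := Nat.floor_le (by positivity)
  have hRge : y ≤ R := by
    have := Nat.lt_floor_add_one (y ^ 2)
    nlinarith
  have hR2 : 2 ≤ R := by exact_mod_cast hy2.trans hRge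
  have hsub : s ⊆ insert a ((Ioc a (a + ⌊h⌋₊)).filter Nat.Prime) := by
    intro p hp
    obtain ⟨hpp, hap, hph⟩ := hs p hp
    rw [mem_insert, mem_filter, mem_Ioc]
    rcases hap.eq_or_lt with rfl | hlt
    · exact Or.inl rfl
    · refine Or.inr ⟨⟨hlt, ?_⟩, hpp⟩
      have : p - a ≤ ⌊h⌋₊ := by
        refine Nat.le_floor ?_
        rw [Nat.cast_sub hap]
        linarith
      omega
  have hcard : (s.card : ℝ) ≤ (((Ioc a (a + ⌊h⌋₊)).filter Nat.Prime).card : ℝ) + 1 := by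
    exact_mod_cast (card_le_card hsub).trans (card_insert_le _ _)
  have hsieve := card_primes_Ioc_le a ⌊h⌋₊ hR2
  have hlogyR : Real.log y ≤ Real.log R := Real.log_le_log hy0 hRge
  have hlogy0 : 0 < Real.log y := Real.log_pos (by linarith)
  have hmain : 2 * (⌊h⌋₊ : ℝ) / Real.log R ≤ 32 * (h / Real.log h) := by
    have : 32 * (h / Real.log h) = 2 * h / Real.log y := by
      rw [hlogy]; field_simp; norm_num
    rw [this]
    have := Nat.floor_le h0.le
    gcongr
  have hR4 : (R : ℝ) ^ 4 ≤ y ^ 8 := by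
    calc (R : ℝ) ^ 4 ≤ (y ^ 2) ^ 4 := by gcongr
      _ = y ^ 8 := by ring
  have hy28 : y ^ 2 ≤ y ^ 8 := pow_le_pow_right₀ (by linarith) (by norm_num)
  have hone : 1 ≤ y ^ 8 := one_le_pow₀ (by linarith)
  have hrest : 3 * y ^ 8 ≤ h / Real.log h := by
    rw [le_div_iff₀ hlogpos]
    have : y ^ 8 * y ^ 8 = h := by rw [← hy16]; ring
    nlinarith [pow_pos hy0 8]
  linarith

/-- A real number at which the cosine is small is close to the zero of the cosine in its interval
`[k π, (k + 1) π)`. -/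
lemma abs_sub_le_of_abs_cos_lt {x δ : ℝ} (hδ : |Real.cos x| < δ) :
    |x - Real.pi * (⌊x / Real.pi⌋ + 1 / 2)| ≤ Real.pi / 2 * δ := by
  have hpi := Real.pi_pos
  set k := ⌊x / Real.pi⌋ with hk
  set r := x - Real.pi * (k + 1 / 2) with hr
  have h1 : (k : ℝ) * Real.pi ≤ x := (le_div_iff₀ hpi).mp (Int.floor_le _)
  have h2 : x < (k + 1 : ℝ) * Real.pi := (div_lt_iff₀ hpi).mp (Int.lt_floor_add_one _)
  have hrle : |r| ≤ Real.pi / 2 := by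
    rw [abs_le]; constructor <;> · rw [hr]; linarith
  have hsin : |Real.sin r| = |Real.cos x| := by
    have : r = x - Real.pi / 2 - k * Real.pi := by rw [hr]; ring
    rw [this, Real.sin_sub_int_mul_pi, abs_mul, abs_zpow, abs_neg, abs_one, one_zpow, one_mul,
      Real.sin_sub_pi_div_two, abs_neg]
  have h3 := Real.mul_abs_le_abs_sin hrle
  rw [hsin] at h3
  have h4 : |r| = Real.pi / 2 * (2 / Real.pi * |r|) := by field_simp
  rw [h4]
  exact mul_le_mul_of_nonneg_left (h3.trans hδ.le) (by positivity)

/-- Two primes whose phases `T log p` lie near the same zero of the cosine are close together. -/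
lemma sub_le_of_abs_cos_lt {T δ N p q : ℝ} (hT : 1 ≤ T) (hδ0 : 0 < δ) (hδ : δ ≤ 1 / 4)
    (hp : 0 < p) (hp2 : p ≤ 2 * N) (hq : 0 < q) (hcp : |Real.cos (T * Real.log p)| < δ)
    (hcq : |Real.cos (T * Real.log q)| < δ)
    (hk : ⌊T * Real.log p / Real.pi⌋ = ⌊T * Real.log q / Real.pi⌋) :
    q ≤ p + 16 * N * δ / T := by
  have hT0 : 0 < T := by linarith
  have h1 := abs_le.mp (abs_sub_le_of_abs_cos_lt hcp)
  have h2 := abs_le.mp (abs_sub_le_of_abs_cos_lt hcq)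
  rw [hk] at h1
  have hpi := Real.pi_le_four
  have h3 : T * (Real.log q - Real.log p) ≤ 4 * δ := by
    nlinarith [h1.1, h2.2]
  have h4 : Real.log (q / p) ≤ 4 * δ / T := by
    rw [Real.log_div hq.ne' hp.ne', le_div_iff₀ hT0]; linarith
  set x := 4 * δ / T with hx
  have hx0 : 0 ≤ x := by positivity
  have hx1 : x ≤ 1 := by
    rw [hx, div_le_one hT0]; linarith
  have h5 : q / p ≤ Real.exp x := by
    rw [← Real.log_le_iff_le_exp (div_pos hq hp)]; exact h4
  have h6 : Real.exp x ≤ 1 + 2 * x := by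
    have := (abs_le.mp (Real.abs_exp_sub_one_le (x := x) (by rwa [abs_of_nonneg hx0]))).2
    rw [abs_of_nonneg hx0] at this
    linarith
  have h7 : q ≤ (1 + 2 * x) * p := (div_le_iff₀ hp).mp (h5.trans h6)
  have h8 : x * p ≤ x * (2 * N) := mul_le_mul_of_nonneg_left hp2 hx0
  have h9 : 16 * N * δ / T = 2 * (x * (2 * N)) := by rw [hx]; ring
  rw [h9]
  linarith

/-- The primes in `(N, 2 * N]` for which `cos (T log p)` is small lie in at most `3 T` intervals of
length `16 N δ / T`, one for each value of `⌊T log p / π⌋`; each of them contains few primes by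
the short-interval bound `hh₀`. -/
lemma card_primes_abs_cos_lt_le {h₀ : ℝ} (hh₀ : ∀ h : ℝ, h₀ ≤ h → ∀ (a : ℕ) (s : Finset ℕ),
    (∀ p ∈ s, p.Prime ∧ a ≤ p ∧ (p : ℝ) ≤ a + h) → (s.card : ℝ) ≤ 33 * (h / Real.log h))
    {N T δ : ℝ} (hN : 1 ≤ N) (hT : 1 ≤ T) (hδ0 : 0 < δ) (hδ : δ ≤ 1 / 4)
    (hh : h₀ ≤ 16 * N * δ / T) (hlog : 0 ≤ Real.log (16 * N * δ / T)) :
    (((Ioc ⌊N⌋₊ ⌊2 * N⌋₊).filter fun p : ℕ ↦ p.Prime ∧ |Real.cos (T * Real.log p)| < δ).card : ℝ) ≤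
      1584 * δ * (N / Real.log (16 * N * δ / T)) := by
  set h := 16 * N * δ / T with hh'
  set B := (Ioc ⌊N⌋₊ ⌊2 * N⌋₊).filter fun p : ℕ ↦ p.Prime ∧ |Real.cos (T * Real.log p)| < δ with hB
  have hT0 : 0 < T := by linarith
  have hpi := Real.pi_pos
  have hmem {p : ℕ} (hp : p ∈ B) : N ≤ p ∧ (p : ℝ) ≤ 2 * N ∧ p.Prime ∧
      |Real.cos (T * Real.log p)| < δ := by
    rw [hB, mem_filter, mem_Ioc] at hp
    refine ⟨((Nat.floor_lt (by linarith)).mp hp.1.1).le, ?_, hp.2.1, hp.2.2⟩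
    exact (Nat.le_floor_iff (by linarith)).mp hp.1.2
  set k : ℕ → ℤ := fun p ↦ ⌊T * Real.log p / Real.pi⌋ with hk
  set K := Finset.Icc ⌊T * Real.log N / Real.pi⌋ ⌊T * Real.log (2 * N) / Real.pi⌋ with hK
  have hmaps : Set.MapsTo k B K := by
    intro p hp
    obtain ⟨h1, h2, -, -⟩ := hmem hp
    rw [hK, coe_Icc, Set.mem_Icc]
    constructor <;> refine Int.floor_mono ?_
    · have := Real.log_le_log (by linarith) h1
      gcongr
    · have := Real.log_le_log (by linarith) h2
      gcongr
  have hKcard : (K.card : ℝ) ≤ 3 * T := by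
    have h1 := Int.floor_le (T * Real.log (2 * N) / Real.pi)
    have h2 := Int.lt_floor_add_one (T * Real.log N / Real.pi)
    have h3 : ⌊T * Real.log N / Real.pi⌋ ≤ ⌊T * Real.log (2 * N) / Real.pi⌋ := by
      refine Int.floor_mono ?_
      have := Real.log_le_log (by linarith) (show N ≤ 2 * N by linarith)
      gcongr
    have h4 : (K.card : ℤ) = ⌊T * Real.log (2 * N) / Real.pi⌋ + 1 - ⌊T * Real.log N / Real.pi⌋ := by
      rw [hK, Int.card_Icc, Int.toNat_of_nonneg (by omega)]
    have h5 : (K.card : ℝ) =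
        ⌊T * Real.log (2 * N) / Real.pi⌋ + 1 - ⌊T * Real.log N / Real.pi⌋ := by
      exact_mod_cast h4
    have h6 : T * Real.log (2 * N) / Real.pi = T * Real.log N / Real.pi +
        T * (Real.log 2 / Real.pi) := by
      rw [Real.log_mul (by norm_num) (by linarith)]; ring
    have h7 : Real.log 2 / Real.pi ≤ 1 := by
      rw [div_le_one hpi]
      linarith [Real.log_two_lt_d9, Real.pi_gt_three]
    have h8 : T * (Real.log 2 / Real.pi) ≤ T * 1 := mul_le_mul_of_nonneg_left h7 hT0.le
    rw [h5]
    linarith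
  have hfib : ∀ b ∈ K, (((B.filter fun p ↦ k p = b).card : ℕ) : ℝ) ≤ 33 * (h / Real.log h) := by
    intro b _
    rcases (B.filter fun p ↦ k p = b).eq_empty_or_nonempty with he | hne
    · rw [he, card_empty, Nat.cast_zero]
      positivity
    · have ha := min'_mem _ hne
      refine hh₀ h hh ((B.filter fun p ↦ k p = b).min' hne) _ fun p hp ↦ ?_
      rw [mem_filter] at ha
      have hp' := mem_filter.mp hp
      obtain ⟨a1, a2, a3, a4⟩ := hmem ha.1
      obtain ⟨p1, p2, p3, p4⟩ := hmem hp'.1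
      refine ⟨p3, min'_le _ p hp, ?_⟩
      exact sub_le_of_abs_cos_lt hT hδ0 hδ (by linarith) a2 (by linarith) a4 p4
        (ha.2.trans hp'.2.symm)
  have hX : 0 ≤ 33 * (h / Real.log h) := by positivity
  calc (B.card : ℝ) = ∑ b ∈ K, ((B.filter fun p ↦ k p = b).card : ℝ) := by
        exact_mod_cast card_eq_sum_card_fiberwise hmaps
    _ ≤ K.card • (33 * (h / Real.log h)) := sum_le_card_nsmul _ _ _ hfib
    _ ≤ 3 * T * (33 * (h / Real.log h)) := by
        rw [nsmul_eq_mul]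
        exact mul_le_mul_of_nonneg_right hKcard hX
    _ = 1584 * δ * (N / Real.log h) := by
        rw [hh']; field_simp; norm_num

/-- With `x = n t log p` one has `η(p) = 2 cos x` and `p ^ (2 n i t) + 1 = 2 cos x * exp (i x)`. -/
lemma norm_divisorEta_prime (n : ℕ) (t : ℝ) {p : ℕ} (hp : p.Prime) :
    ‖divisorEta (n * Complex.I * t) p‖ = 2 * |Real.cos (n * |t| * Real.log p)| ∧
      ‖(p : ℂ) ^ (2 * n * Complex.I * t) + 1‖ = 2 * |Real.cos (n * |t| * Real.log p)| := by
  set x : ℝ := n * t * Real.log p with hx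
  have hp0 : (0 : ℝ) < p := by exact_mod_cast hp.pos
  have hpc : (p : ℂ) ≠ 0 := by exact_mod_cast hp.ne_zero
  have hlog : Complex.log (p : ℂ) = (Real.log p : ℝ) := Complex.natCast_log.symm
  have hcos : |Real.cos (n * |t| * Real.log p)| = |Real.cos x| := by
    rcases abs_choice t with h | h
    · rw [h]
    · rw [h, ← Real.cos_neg, hx]; congr 2; ring
  have e1 : (p : ℂ) ^ (n * Complex.I * t) = Complex.exp (x * Complex.I) := by
    rw [Complex.cpow_def_of_ne_zero hpc, hlog, hx]
    congr 1; push_cast; ring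
  have e2 : ((p : ℂ)⁻¹) ^ (n * Complex.I * t) = Complex.exp (-x * Complex.I) := by
    rw [Complex.inv_cpow _ _ (by rw [Complex.natCast_arg]; exact Real.pi_pos.ne), e1,
      ← Complex.exp_neg, neg_mul]
  have e3 : (p : ℂ) ^ (2 * n * Complex.I * t) =
      Complex.exp (x * Complex.I) * Complex.exp (x * Complex.I) := by
    rw [Complex.cpow_def_of_ne_zero hpc, hlog, hx, ← Complex.exp_add]
    congr 1; push_cast; ring
  have heta : divisorEta (n * Complex.I * t) p = ((2 * Real.cos x : ℝ) : ℂ) := by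
    unfold divisorEta
    rw [Nat.sum_divisorsAntidiagonal (fun a b ↦ ((a : ℂ) / (b : ℂ)) ^ (n * Complex.I * t)),
      hp.sum_divisors]
    rw [Nat.div_self hp.pos, Nat.div_one, Nat.cast_one, div_one, one_div, e1, e2]
    push_cast
    rw [Complex.two_cos]
  have hnorm : ‖((2 * Real.cos x : ℝ) : ℂ)‖ = 2 * |Real.cos x| := by
    rw [Complex.norm_real, Real.norm_eq_abs, abs_mul, abs_two]
  refine ⟨by rw [heta, hnorm, hcos], ?_⟩
  have : (p : ℂ) ^ (2 * n * Complex.I * t) + 1 =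
      Complex.exp (x * Complex.I) * ((2 * Real.cos x : ℝ) : ℂ) := by
    have h1 : Complex.exp (x * Complex.I) * Complex.exp (-x * Complex.I) = 1 := by
      rw [← Complex.exp_add]; simp
    rw [e3]
    push_cast
    rw [Complex.two_cos, mul_add, h1]
  rw [this, norm_mul, Complex.norm_exp_ofReal_mul_I, one_mul, hnorm, hcos]

theorem lemma12p15 (n : ℕ) (hn : 1 ≤ n) :
    ∃ N₀ : ℝ, ∀ N t : ℝ, N₀ ≤ N → t ^ 2 ≤ N → 1 ≤ t ^ 2 →
      (1 - 1 / (20 * (n : ℝ) ^ 2)) * (N / Real.log N) ≤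
        ({p : ℕ | p.Prime ∧ N ≤ (p : ℝ) ∧ (p : ℝ) ≤ 2 * N ∧
            ‖divisorEta (n * Complex.I * t) p‖ = ‖(p : ℂ) ^ (2 * n * Complex.I * t) + 1‖ ∧
            1 / (2000 ^ 2 * (n : ℝ) ^ 4) ≤ ‖divisorEta (n * Complex.I * t) p‖}.ncard : ℝ) := by
  have hn1 : (1 : ℝ) ≤ n := by exact_mod_cast hn
  have hn0 : (0 : ℝ) < n := by linarith
  -- the modulus is twice that of the cosine, hence the factor `1 / 2` in `δ`
  set δ : ℝ := 1 / (2 * (2000 ^ 2 * (n : ℝ) ^ 4)) with hδ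
  have hδ0 : 0 < δ := by positivity
  have hn4 : (n : ℝ) ^ 2 ≤ (n : ℝ) ^ 4 := pow_le_pow_right₀ hn1 (by norm_num)
  have hn2 : 1 ≤ (n : ℝ) ^ 2 := one_le_pow₀ hn1
  have hδ4 : δ ≤ 1 / 4 := by
    rw [hδ]
    exact one_div_le_one_div_of_le (by norm_num) (by nlinarith)
  obtain ⟨h₀, hh₀⟩ := eventually_atTop.mp eventually_card_primes_le
  have hroot : Tendsto (fun N : ℝ ↦ N ^ (1 / 4 : ℝ)) atTop atTop :=
    tendsto_rpow_atTop (by norm_num)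
  have hpnt := eventually_le_card_primes_Ioc (show 0 < 1 / (40 * (n : ℝ) ^ 2) by positivity)
  obtain ⟨N₀, hN₀⟩ := eventually_atTop.mp ((eventually_gt_atTop (1 : ℝ)).and (hpnt.and
    ((hroot.eventually_ge_atTop h₀).and (hroot.eventually_ge_atTop (n / (16 * δ))))))
  refine ⟨N₀, fun N t hN ht ht1 ↦ ?_⟩
  obtain ⟨hN1, hcount, hr1, hr2⟩ := hN₀ N hN
  have hN0 : 0 < N := by linarith
  have hlogN : 0 < Real.log N := Real.log_pos hN1
  set y := N ^ (1 / 4 : ℝ) with hy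
  have hy0 : 0 < y := Real.rpow_pos_of_pos hN0 _
  have hy4 : y ^ 4 = N := by
    rw [hy, ← Real.rpow_natCast, ← Real.rpow_mul hN0.le]; norm_num
  have hlogy : Real.log N = 4 * Real.log y := by
    rw [← hy4, Real.log_pow]; norm_num
  have ht1' : 1 ≤ |t| := by
    rw [← one_le_sq_iff_one_le_abs]; exact ht1
  set T : ℝ := n * |t| with hT
  have hT1 : 1 ≤ T := by nlinarith
  have hT0 : 0 < T := by linarith
  have hTle : T ≤ n * y ^ 2 := by
    refine mul_le_mul_of_nonneg_left ?_ hn0.le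
    refine abs_le_of_sq_le_sq ?_ (by positivity)
    calc t ^ 2 ≤ N := ht
      _ = (y ^ 2) ^ 2 := by rw [← hy4]; ring
  -- the intervals near a zero of the cosine have length at least `N ^ (1 / 4)`
  have hlen : y ≤ 16 * N * δ / T := by
    rw [le_div_iff₀ hT0]
    have h1 : n ≤ y * (16 * δ) := (div_le_iff₀ (by positivity)).mp hr2
    calc y * T ≤ y * (n * y ^ 2) := mul_le_mul_of_nonneg_left hTle hy0.le
      _ ≤ y * (y * (16 * δ) * y ^ 2) := by gcongr
      _ = 16 * N * δ := by rw [← hy4]; ring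
  have hloglen : Real.log N / 4 ≤ Real.log (16 * N * δ / T) := by
    have := Real.log_le_log hy0 hlen
    linarith
  have hbad := card_primes_abs_cos_lt_le hh₀ hN1.le hT1 hδ0 hδ4 (hr1.trans hlen)
    (by linarith)
  have hbad2 : 1584 * δ * (N / Real.log (16 * N * δ / T)) ≤
      1 / (40 * (n : ℝ) ^ 2) * (N / Real.log N) := by
    have h1 : N / Real.log (16 * N * δ / T) ≤ 4 * (N / Real.log N) := by
      calc N / Real.log (16 * N * δ / T) ≤ N / (Real.log N / 4) :=
            div_le_div_of_nonneg_left hN0.le (by linarith) hloglen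
        _ = 4 * (N / Real.log N) := by field_simp
    have h2 : 1584 * δ * 4 ≤ 1 / (40 * (n : ℝ) ^ 2) := by
      rw [hδ, mul_one_div, div_mul_eq_mul_div, div_le_div_iff₀ (by positivity) (by positivity)]
      nlinarith
    calc _ ≤ 1584 * δ * (4 * (N / Real.log N)) := mul_le_mul_of_nonneg_left h1 (by positivity)
      _ = 1584 * δ * 4 * (N / Real.log N) := by ring
      _ ≤ _ := mul_le_mul_of_nonneg_right h2 (by positivity)
  set P := (Ioc ⌊N⌋₊ ⌊2 * N⌋₊).filter Nat.Prime with hP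
  set G := P.filter fun p : ℕ ↦ ¬ |Real.cos (T * Real.log p)| < δ with hG
  have hsplit : ((P.filter fun p : ℕ ↦ |Real.cos (T * Real.log p)| < δ).card : ℝ) + G.card = P.card := by
    exact_mod_cast card_filter_add_card_filter_not _
  rw [← filter_filter] at hbad
  set S := {p : ℕ | p.Prime ∧ N ≤ (p : ℝ) ∧ (p : ℝ) ≤ 2 * N ∧
    ‖divisorEta (n * Complex.I * t) p‖ = ‖(p : ℂ) ^ (2 * n * Complex.I * t) + 1‖ ∧
    1 / (2000 ^ 2 * (n : ℝ) ^ 4) ≤ ‖divisorEta (n * Complex.I * t) p‖} with hS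
  have hSfin : S.Finite := by
    refine (Set.finite_Iic ⌊2 * N⌋₊).subset fun p hp ↦ ?_
    exact (Nat.le_floor_iff (by linarith)).mpr hp.2.2.1
  have hGS : (G : Set ℕ) ⊆ S := by
    intro p hp
    rw [mem_coe, hG, mem_filter, hP, mem_filter, mem_Ioc] at hp
    obtain ⟨⟨⟨h1, h2⟩, hpp⟩, hc⟩ := hp
    obtain ⟨e1, e2⟩ := norm_divisorEta_prime n t hpp
    refine ⟨hpp, ((Nat.floor_lt hN0.le).mp h1).le, (Nat.le_floor_iff (by linarith)).mp h2,
      e1.trans e2.symm, ?_⟩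
    rw [e1]
    have : 1 / (2000 ^ 2 * (n : ℝ) ^ 4) = 2 * δ := by rw [hδ]; field_simp
    rw [this]
    linarith [not_lt.mp hc]
  have hGcard : (G.card : ℝ) ≤ S.ncard := by
    rw [← Set.ncard_coe_finset]
    exact_mod_cast Set.ncard_le_ncard hGS hSfin
  have hfinal : (1 - 1 / (20 * (n : ℝ) ^ 2)) * (N / Real.log N) =
      (1 - 1 / (40 * (n : ℝ) ^ 2)) * (N / Real.log N) -
        1 / (40 * (n : ℝ) ^ 2) * (N / Real.log N) := by
    field_simp; ring
  rw [hfinal]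
  linarith
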